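/- Let $\Lambda=(\lambda_i)_{i=0}^\infty$ be a sequence of real numbers with $0=\lambda_0<\lambda_1<\lambda_2<\cdots$, and let $M(\Lambda)$ denote the set of all finite linear combinations with real coefficients of the functions $x^{\lambda_0},x^{\lambda_1},x^{\lambda_2},\dots$ on $[0,\infty)$ (where $x^{\lambda_0}=1$ for all $x$). Let $A\subset[0,\infty)$ be a compact set of positive Lebesgue measure, and let $C[A]$ be the space of all real-valued continuous functions on $A$ with the uniform norm. Then (the set of restrictions to $A$ of the elements of) $M(\Lambda)$ is dense in $C[A]$ if and only if $\sum_{i=1}^\infty 1/\lambda_i=\infty$. -/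

import Mathlib

open Filter MeasureTheory

/-- An exponent sequence `0 = lam 0 < lam 1 < lam 2 < ...` of real numbers (not assumed unbounded). -/
structure IsMuntzSequence (lam : ℕ → ℝ) : Prop where
  zero : lam 0 = 0
  strictMono : StrictMono lam

theorem IsMuntzSequence.nonneg {lam : ℕ → ℝ} (h : IsMuntzSequence lam) (i : ℕ) : 0 ≤ lam i :=
  h.zero ▸ h.strictMono.monotone (Nat.zero_le i)

/-- The function `x ↦ x ^ a`, `a ≥ 0`, as an element of `C(A, ℝ)`. It is used for `A ⊆ [0, ∞)`;
for `a = 0` it is the constant function `1`, also at `x = 0`. -/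
noncomputable def muntzPower (A : Set ℝ) (a : ℝ) (ha : 0 ≤ a) : C(A, ℝ) where
  toFun x := (x : ℝ) ^ a
  continuous_toFun := (Real.continuous_rpow_const ha).comp continuous_subtype_val

/-- The Müntz space on `A`: all finite real linear combinations of the functions `x ^ lam i`,
`i = 0, 1, 2, ...`, viewed as functions on `A`. -/
noncomputable def muntzSpace (A : Set ℝ) (lam : ℕ → ℝ) (h : IsMuntzSequence lam) :
    Submodule ℝ C(A, ℝ) :=
  Submodule.span ℝ (Set.range fun i : ℕ => muntzPower A (lam i) (h.nonneg i))

/-! Convergent case. Put `x = exp t` and discard a neighbourhood of `0`, so that `A` becomes a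
compact set `E` of positive measure. If `p` in the Müntz space is close to `1 / x`, then `x * (1 / x
- p)` is a small exponential sum with exponents `0, lam 0 + 1, lam 1 + 1, ...` and constant
coefficient `1`. This is impossible once the constant coefficient is bounded by a multiple of the
uniform norm on `E`, independent of the number of terms (`exists_coeff_zero_le_compact`).

On an interval, such a bound comes from functions `g` of integral `1` that annihilate the first `m`
nonconstant exponentials and have mean squares bounded in `m` (`exists_annihilating_functions`).
Duality and a Carathéodory reduction turn it into a formula with exactly as many nodes as exponents
and controlled total weight (`exists_nodes`). The weights are the constant coefficients of the
Lagrange functions of the nodes. An expanding map carries the nodes into `E`, and spreading nodes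
apart only shrinks these coefficients (`IsLagrangeCoeff.abs_coeff_zero_le_of_gaps`), so the bound
survives on `E`. The monotonicity rests on the exact sign pattern of a sum having the maximal number
of zeros.

Divergent case. Von Golitschek's construction approximates `x ^ q` with error at most a constant
times `∏ |1 - q / lam i|`, which tends to `0` for `q < lam 1`. All small powers are then in the
closure, the same estimate extends this to all positive powers, and Weierstrass' theorem finishes.
-/

/-! ### Zeros of exponential sums -/

/-- The exponential sum with exponents `μ j` and coefficients `a j`. -/
noncomputable def expSum {n : ℕ} (μ a : Fin n → ℝ) (t : ℝ) : ℝ :=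
  ∑ j, a j * Real.exp (μ j * t)

theorem expSum_sub {n : ℕ} (μ a b : Fin n → ℝ) (t : ℝ) :
    expSum μ (a - b) t = expSum μ a t - expSum μ b t := by
  simp [expSum, sub_mul, Finset.sum_sub_distrib]

theorem expSum_succ {n : ℕ} (μ a : Fin (n + 1) → ℝ) (t : ℝ) :
    expSum μ a t = a 0 * Real.exp (μ 0 * t) + expSum (Fin.tail μ) (Fin.tail a) t := by
  simp [expSum, Fin.sum_univ_succ, Fin.tail]

theorem hasDerivAt_expSum {n : ℕ} (μ a : Fin n → ℝ) (t : ℝ) :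
    HasDerivAt (expSum μ a) (expSum μ (fun j => a j * μ j) t) t := by
  unfold expSum
  refine HasDerivAt.fun_sum fun j _ => ?_
  have := (((hasDerivAt_id t).const_mul (μ j)).exp).const_mul (a j)
  refine this.congr_deriv ?_
  simp only [id, mul_one]; ring

/-- Rolle's theorem for a finite set of zeros. -/
theorem exists_finset_deriv_zeros {f f' : ℝ → ℝ} (hf : ∀ t, HasDerivAt f (f' t) t)
    (W : Finset ℝ) {m : ℕ} (hm : W.card = m + 1) (hW : ∀ t ∈ W, f t = 0) :
    ∃ W' : Finset ℝ, W'.card = m ∧ Disjoint W' W ∧ ∀ t ∈ W', f' t = 0 := by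
  let w := W.orderEmbOfFin hm
  have hw : ∀ k, f (w k) = 0 := fun k => hW _ (W.orderEmbOfFin_mem hm k)
  have hcont : Continuous f := continuous_iff_continuousAt.2 fun t => (hf t).continuousAt
  have key : ∀ i : Fin m, ∃ z ∈ Set.Ioo (w i.castSucc) (w i.succ), f' z = 0 := fun i =>
    exists_hasDerivAt_eq_zero (w.strictMono i.castSucc_lt_succ) hcont.continuousOn
      (by rw [hw, hw]) fun t _ => hf t
  choose z hz hz' using key
  have hzmono : StrictMono z := fun i k hik =>
    ((hz i).2.trans_le (w.monotone (by simpa [Fin.le_def] using hik))).trans (hz k).1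
  refine ⟨Finset.univ.map ⟨z, hzmono.injective⟩, by simp, ?_, by simpa using hz'⟩
  rw [Finset.disjoint_left]
  intro t ht htW
  obtain ⟨i, -, rfl⟩ := Finset.mem_map.1 ht
  obtain ⟨k, hk⟩ : z i ∈ Set.range w := by rw [Finset.range_orderEmbOfFin]; exact htW
  have h1 := (hz i).1
  have h2 := (hz i).2
  rw [← hk, w.lt_iff_lt] at h1 h2
  simp only [Fin.lt_def, Fin.val_castSucc, Fin.val_succ] at h1 h2
  omega

/-- Induction by Rolle: dividing by `exp (μ 0 * t)` makes the first term constant, so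
differentiation costs one term and one zero. -/
theorem expSum_coeff_eq_zero {n : ℕ} {μ : Fin n → ℝ} (hμ : Function.Injective μ) (a : Fin n → ℝ)
    (W : Finset ℝ) (hW : n ≤ W.card) (h : ∀ t ∈ W, expSum μ a t = 0) : a = 0 := by
  induction n generalizing W with
  | zero => exact Subsingleton.elim _ _
  | succ n ih =>
    obtain ⟨V, hVW, hV⟩ := Finset.exists_subset_card_eq hW
    let ν : Fin (n + 1) → ℝ := fun j => μ j - μ 0
    have hν : ∀ t, expSum ν a t = Real.exp (-(μ 0 * t)) * expSum μ a t := fun t => by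
      simp only [expSum, Finset.mul_sum, ν]
      refine Finset.sum_congr rfl fun j _ => ?_
      rw [mul_left_comm, ← Real.exp_add]; ring_nf
    obtain ⟨V', hV', -, hz⟩ := exists_finset_deriv_zeros (hasDerivAt_expSum ν a) V hV
      fun t ht => by rw [hν, h t (hVW ht), mul_zero]
    have htail : Fin.tail (fun j => a j * ν j) = 0 := by
      refine ih (μ := Fin.tail ν) ?_ _ V' hV'.ge fun t ht => ?_
      · intro i j hij
        exact Fin.succ_injective _ (hμ (by simpa [Fin.tail, ν] using hij))
      · have := hz t ht
        rw [expSum_succ] at this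
        simpa [ν] using this
    have hsucc : ∀ j : Fin n, a j.succ = 0 := fun j => by
      have h0 := congrFun htail j
      simp only [Fin.tail, Pi.zero_apply, mul_eq_zero, ν, sub_eq_zero] at h0
      exact h0.resolve_right fun hh => Fin.succ_ne_zero j (hμ hh)
    obtain ⟨t, ht⟩ : V.Nonempty := by rw [← Finset.card_pos]; omega
    have h0 := h t (hVW ht)
    rw [expSum_succ] at h0
    have : expSum (Fin.tail μ) (Fin.tail a) t = 0 := by simp [expSum, Fin.tail, hsucc]
    rw [this, add_zero, mul_eq_zero] at h0
    funext j
    refine Fin.cases (h0.resolve_right (Real.exp_ne_zero _)) hsucc j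

/-! ### Sign pattern of sums with the maximal number of zeros -/

theorem analyticAt_expSum {n : ℕ} (μ a : Fin n → ℝ) (t : ℝ) : AnalyticAt ℝ (expSum μ a) t := by
  unfold expSum
  fun_prop

theorem AnalyticAt.dslope_real {f : ℝ → ℝ} {c : ℝ} (hf : ∀ t, AnalyticAt ℝ f t) (t : ℝ) :
    AnalyticAt ℝ (dslope f c) t := by
  rcases eq_or_ne t c with rfl | hne
  · obtain ⟨p, hp⟩ := hf t
    exact ⟨_, hp.has_fpower_series_dslope_fslope⟩
  · have h1 : AnalyticAt ℝ (fun u => (u - c)⁻¹ * (f u - f c)) t :=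
      ((analyticAt_id.sub analyticAt_const).inv (sub_ne_zero.2 hne)).mul
        ((hf t).sub analyticAt_const)
    refine h1.congr ?_
    filter_upwards [isOpen_ne.mem_nhds hne] with u hu
    rw [dslope_of_ne _ hu, slope_def_field]
    field_simp

theorem exists_eq_prod_mul_of_zeros {f : ℝ → ℝ} (hf : ∀ t, AnalyticAt ℝ f t) (W : Finset ℝ)
    (hW : ∀ w ∈ W, f w = 0) :
    ∃ g : ℝ → ℝ, (∀ t, AnalyticAt ℝ g t) ∧ ∀ u, f u = (∏ w ∈ W, (w - u)) * g u := by
  induction W using Finset.induction_on with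
  | empty => exact ⟨f, hf, by simp⟩
  | insert w W hw ih =>
    obtain ⟨g, hg, hfg⟩ := ih fun v hv => hW v (Finset.mem_insert_of_mem hv)
    have hgw : g w = 0 := by
      have := hW w (Finset.mem_insert_self _ _)
      rw [hfg, mul_eq_zero, Finset.prod_eq_zero_iff] at this
      refine this.resolve_left ?_
      rintro ⟨v, hv, h⟩
      exact hw (sub_eq_zero.1 h ▸ hv)
    refine ⟨fun u => - dslope g w u, fun t => (AnalyticAt.dslope_real hg t).neg, fun u => ?_⟩
    rw [Finset.prod_insert hw, hfg]
    have := sub_smul_dslope g w u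
    rw [hgw, sub_zero, smul_eq_mul] at this
    rw [← this]; ring

/-- Without its constant term the sum would have `n` terms and `n` zeros. -/
theorem expSum_coeff_zero_ne_zero {n : ℕ} {μ : Fin (n + 1) → ℝ} (hμ : StrictMono μ)
    {a : Fin (n + 1) → ℝ} (ha : a ≠ 0) {W : Finset ℝ}
    (hW : W.card = n) (hz : ∀ w ∈ W, expSum μ a w = 0) : a 0 ≠ 0 := by
  intro ha0
  have ht : Fin.tail a = 0 := by
    refine expSum_coeff_eq_zero (μ := Fin.tail μ) ?_ _ W hW.ge fun w hw => ?_
    · exact hμ.injective.comp (Fin.succ_injective _)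
    · have := hz w hw
      rwa [expSum_succ, ha0, zero_mul, zero_add] at this
  exact ha (funext fun j => Fin.cases ha0 (fun i => congrFun ht i) j)

/-- The zeros are simple: the derivative has only `n` terms because `μ 0 = 0`, and Rolle already
gives it `n - 1` zeros off `W`; a double zero would be one too many. -/
theorem expSum_deriv_ne_zero {n : ℕ} {μ : Fin (n + 1) → ℝ} (h0 : μ 0 = 0)
    (hμ : StrictMono μ)
    {a : Fin (n + 1) → ℝ} (ha : a ≠ 0) {W : Finset ℝ}
    (hW : W.card = n) (hz : ∀ w ∈ W, expSum μ a w = 0) {w : ℝ} (hw : w ∈ W) :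
    expSum μ (fun j => a j * μ j) w ≠ 0 := by
  intro hd
  obtain ⟨m, rfl⟩ : ∃ m, n = m + 1 := Nat.exists_eq_succ_of_ne_zero (by
    rw [← hW]; exact (Finset.card_pos.2 ⟨w, hw⟩).ne')
  obtain ⟨V, hV, hdis, hVz⟩ := exists_finset_deriv_zeros (hasDerivAt_expSum μ a) W hW hz
  have hwV : w ∉ V := fun h => Finset.disjoint_left.1 hdis h hw
  have htail : Fin.tail (fun j => a j * μ j) = 0 := by
    refine expSum_coeff_eq_zero (μ := Fin.tail μ) ?_ _ (insert w V) ?_ fun t ht => ?_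
    · exact hμ.injective.comp (Fin.succ_injective _)
    · rw [Finset.card_insert_of_notMem hwV, hV]
    · have : expSum μ (fun j => a j * μ j) t = 0 := by
        rcases Finset.mem_insert.1 ht with rfl | h
        exacts [hd, hVz t h]
      rwa [expSum_succ, h0, mul_zero, zero_mul, zero_add] at this
  have hsucc : ∀ j, a (Fin.succ j) = 0 := fun j => by
    have := congrFun htail j
    simp only [Fin.tail, Pi.zero_apply, mul_eq_zero] at this
    refine this.resolve_right fun hh => ?_
    have := hμ (Fin.succ_pos j)
    rw [h0, hh] at this
    exact lt_irrefl _ this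
  refine expSum_coeff_zero_ne_zero hμ ha hW hz ?_
  have := hz w hw
  rw [expSum_succ, h0] at this
  have h' : expSum (Fin.tail μ) (Fin.tail a) w = 0 := by simp [expSum, Fin.tail, hsucc]
  simpa [h'] using this

theorem tendsto_expSum_atBot {n : ℕ} {μ : Fin (n + 1) → ℝ} (h0 : μ 0 = 0)
    (hμ : StrictMono μ)
    (a : Fin (n + 1) → ℝ) : Tendsto (expSum μ a) atBot (nhds (a 0)) := by
  have h : Tendsto (fun t => a 0 + ∑ j : Fin n, a j.succ * Real.exp (μ j.succ * t)) atBot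
      (nhds (a 0 + ∑ j : Fin n, a j.succ * 0)) := by
    refine tendsto_const_nhds.add (tendsto_finsetSum _ fun j _ => Tendsto.const_mul _ ?_)
    refine Real.tendsto_exp_atBot.comp (tendsto_id.const_mul_atBot ?_)
    rw [← h0]; exact hμ (Fin.succ_pos j)
  simp only [mul_zero, Finset.sum_const_zero, add_zero] at h
  refine h.congr fun t => ?_
  simp [expSum, Fin.sum_univ_succ, h0]

/-- An exponential sum with `n + 1` terms changes sign exactly at its `n` zeros. -/
theorem expSum_mul_coeff_mul_prod_pos {n : ℕ} {μ : Fin (n + 1) → ℝ} (h0 : μ 0 = 0)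
    (hμ : StrictMono μ)
    {a : Fin (n + 1) → ℝ} (ha : a ≠ 0) {W : Finset ℝ}
    (hW : W.card = n) (hz : ∀ w ∈ W, expSum μ a w = 0) {u : ℝ} (hu : u ∉ W) :
    0 < expSum μ a u * a 0 * ∏ w ∈ W, (w - u) := by
  obtain ⟨g, hg, hfg⟩ := exists_eq_prod_mul_of_zeros (analyticAt_expSum μ a) W hz
  have hgcont : Continuous g := continuous_iff_continuousAt.2 fun t => (hg t).continuousAt
  have ha0 := expSum_coeff_zero_ne_zero hμ ha hW hz
  have hprod : ∀ v, v ∉ W → ∏ w ∈ W, (w - v) ≠ 0 := fun v hv =>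
    Finset.prod_ne_zero_iff.2 fun w hw h => hv (sub_eq_zero.1 h ▸ hw)
  -- A zero of `g` in `W` would be a double zero of the sum; outside `W` it would be an additional
  -- zero.
  have hg0 : ∀ v, g v ≠ 0 := by
    intro v hv
    by_cases hvW : v ∈ W
    · refine expSum_deriv_ne_zero h0 hμ ha hW hz hvW ?_
      have h1 := hasDerivAt_expSum μ a v
      have h2 : HasDerivAt (fun u => (∏ w ∈ W, (w - u)) * g u) _ v :=
        (DifferentiableAt.hasDerivAt (f := fun u => ∏ w ∈ W, (w - u)) (by fun_prop)).mul
          (hg v).differentiableAt.hasDerivAt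
      rw [hv, mul_zero, zero_add, Finset.prod_eq_zero (f := fun w => w - v) hvW (sub_self v), zero_mul] at h2
      exact h1.unique (by simpa only [← hfg] using h2)
    · have hv0 : expSum μ a v = 0 := by rw [hfg, hv, mul_zero]
      refine ha (expSum_coeff_eq_zero hμ.injective a (insert v W) ?_ fun t ht => ?_)
      · rw [Finset.card_insert_of_notMem hvW, hW]
      · rcases Finset.mem_insert.1 ht with rfl | h
        exacts [hv0, hz t h]
  -- Near `-∞` the sum is close to `a 0` and all factors `w - v` are positive; this fixes the
  -- constant sign of `g`.
  have hev : ∀ᶠ v in atBot, 0 < expSum μ a v * a 0 :=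
    ((tendsto_expSum_atBot h0 hμ a).mul_const (a 0)).eventually
      (lt_mem_nhds (mul_self_pos.2 ha0))
  have hev2 : ∀ᶠ v in atBot, ∀ w ∈ W, v < w :=
    (Finset.eventually_all W).2 fun w _ => eventually_lt_atBot w
  obtain ⟨v, hv1, hv2⟩ := (hev.and hev2).exists
  have hgv : 0 < g v * a 0 := by
    rw [hfg, mul_assoc] at hv1
    exact pos_of_mul_pos_right hv1 (Finset.prod_pos fun w hw => sub_pos.2 (hv2 w hw)).le
  have hgu : 0 < g u * a 0 := by
    by_contra hneg
    have hc : Continuous fun t => g t * a 0 := hgcont.mul_const _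
    obtain ⟨t, ht⟩ := mem_range_of_exists_le_of_exists_ge hc ⟨u, not_lt.1 hneg⟩ ⟨v, hgv.le⟩
    exact (mul_ne_zero (hg0 t) ha0) ht
  rw [hfg]
  have : 0 < (g u * a 0) * (∏ w ∈ W, (w - u)) ^ 2 :=
    mul_pos hgu (sq_pos_of_ne_zero (hprod u hu))
  linarith [this, show (∏ w ∈ W, (w - u)) * g u * a 0 * ∏ w ∈ W, (w - u) =
    (g u * a 0) * (∏ w ∈ W, (w - u)) ^ 2 by ring]

/-! ### Lagrange functions and the effect of spreading nodes -/

theorem exists_expSum_interpolating {n : ℕ} {μ : Fin n → ℝ} (hμ : Function.Injective μ)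
    {x : Fin n → ℝ} (hx : Function.Injective x) (c : Fin n → ℝ) :
    ∃ a, ∀ k, expSum μ a (x k) = c k := by
  let L : (Fin n → ℝ) →ₗ[ℝ] (Fin n → ℝ) :=
    { toFun := fun a k => expSum μ a (x k)
      map_add' := fun a b => by
        funext k; simp [expSum, add_mul, Finset.sum_add_distrib]
      map_smul' := fun r a => by
        funext k; simp [expSum, Finset.mul_sum, mul_assoc] }
  have hL : Function.Injective L := by
    rw [injective_iff_map_eq_zero]
    intro a ha
    refine expSum_coeff_eq_zero hμ a (Finset.univ.map ⟨x, hx⟩) (by simp) ?_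
    intro t ht
    obtain ⟨k, -, rfl⟩ := Finset.mem_map.1 ht
    exact congrFun ha k
  obtain ⟨a, ha⟩ := (LinearMap.injective_iff_surjective.1 hL) c
  exact ⟨a, fun k => congrFun ha k⟩

/-- `a` is the coefficient vector of the `i`-th Lagrange function for the nodes `x`. -/
def IsLagrangeCoeff {n : ℕ} (μ x : Fin n → ℝ) (i : Fin n) (a : Fin n → ℝ) : Prop :=
  ∀ k, expSum μ a (x k) = Pi.single (M := fun _ => ℝ) i 1 k

theorem expSum_ext {n : ℕ} {μ : Fin n → ℝ} (hμ : Function.Injective μ) {x : Fin n → ℝ}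
    (hx : Function.Injective x) {a b : Fin n → ℝ}
    (h : ∀ k, expSum μ a (x k) = expSum μ b (x k)) : a = b := by
  refine sub_eq_zero.1 (expSum_coeff_eq_zero hμ _ (Finset.univ.map ⟨x, hx⟩) (by simp) ?_)
  intro t ht
  obtain ⟨k, -, rfl⟩ := Finset.mem_map.1 ht
  rw [expSum_sub]
  exact sub_eq_zero.2 (h k)

theorem IsLagrangeCoeff.ne_zero {n : ℕ} {μ x : Fin n → ℝ} {i : Fin n} {a : Fin n → ℝ}
    (h : IsLagrangeCoeff μ x i a) : a ≠ 0 := by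
  rintro rfl
  have := h i
  simp [expSum] at this

/-- Sign formula for exponential sums vanishing at all but one of the nodes `z`. -/
theorem expSum_mul_coeff_mul_prod_erase_pos {n : ℕ} {μ : Fin (n + 1) → ℝ} (h0 : μ 0 = 0)
    (hμ : StrictMono μ) {a : Fin (n + 1) → ℝ} (ha : a ≠ 0) {z : Fin (n + 1) → ℝ}
    (hz : Function.Injective z) (i : Fin (n + 1)) (haz : ∀ k ≠ i, expSum μ a (z k) = 0) {u : ℝ}
    (hu : ∀ k ≠ i, z k ≠ u) :
    0 < expSum μ a u * a 0 * ∏ k ∈ Finset.univ.erase i, (z k - u) := by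
  have := expSum_mul_coeff_mul_prod_pos h0 hμ ha (W := (Finset.univ.erase i).map ⟨z, hz⟩)
    (by rw [Finset.card_map, Finset.card_erase_of_mem (Finset.mem_univ i)]; simp)
    (u := u) (fun w hw => ?_) (fun hw => ?_)
  · rwa [Finset.prod_map] at this
  · obtain ⟨k, hk, rfl⟩ := Finset.mem_map.1 hw
    exact haz k (Finset.ne_of_mem_erase hk)
  · obtain ⟨k, hk, rfl⟩ := Finset.mem_map.1 hw
    exact hu k (Finset.ne_of_mem_erase hk) rfl

/-- Moving a node away from the `i`-th node decreases the constant coefficient of the `i`-th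
Lagrange function. -/
theorem IsLagrangeCoeff.abs_coeff_zero_le_of_update {n : ℕ} {μ : Fin (n + 1) → ℝ} (h0 : μ 0 = 0)
    (hμ : StrictMono μ) {z : Fin (n + 1) → ℝ} (hz : Function.Injective z) {i l : Fin (n + 1)}
    (hli : l ≠ i) {ξ : ℝ} (hx : Function.Injective (Function.update z l ξ))
    (hξ : (z i < z l ∧ z l < ξ) ∨ (ξ < z l ∧ z l < z i)) {a b : Fin (n + 1) → ℝ}
    (ha : IsLagrangeCoeff μ z i a) (hb : IsLagrangeCoeff μ (Function.update z l ξ) i b) :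
    |b 0| ≤ |a 0| := by
  have hzξ : ∀ k ≠ l, z k ≠ ξ := fun k hk h => hk (hx (by
    rw [Function.update_of_ne hk, Function.update_self, h]))
  have hbξ : expSum μ b ξ = 0 := by
    have := hb l
    rwa [Function.update_self, Pi.single_eq_of_ne hli] at this
  have hbz : ∀ k ≠ l, expSum μ b (z k) = Pi.single (M := fun _ => ℝ) i 1 k := fun k hk => by
    have := hb k
    rwa [Function.update_of_ne hk] at this
  have hξl : ξ ≠ z l := by rcases hξ with h | h <;> [exact h.2.ne'; exact h.1.ne]
  have haξ := expSum_mul_coeff_mul_prod_erase_pos h0 hμ ha.ne_zero hz i (u := ξ)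
    (fun k hk => by rw [ha k, Pi.single_eq_of_ne hk])
    (fun k hk => if hkl : k = l then hkl ▸ hξl.symm else hzξ k hkl)
  have haξ0 : expSum μ a ξ ≠ 0 := fun h => by simp [h] at haξ
  -- Both Lagrange functions equal `1` at `z i`, so `a - b` vanishes at every `z k` with `k ≠ l`; it
  -- takes the value `expSum μ a ξ` at `ξ`.
  have hd : a - b ≠ 0 := fun h => haξ0 (by rw [sub_eq_zero.1 h, hbξ])
  have hdξ := expSum_mul_coeff_mul_prod_erase_pos h0 hμ hd hz l (u := ξ)
    (fun k hk => by rw [expSum_sub, ha k, hbz k hk, sub_self]) hzξ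
  rw [expSum_sub, hbξ, sub_zero, Pi.sub_apply] at hdξ
  have hai := expSum_mul_coeff_mul_prod_erase_pos h0 hμ ha.ne_zero hz i (u := z i)
    (fun k hk => by rw [ha k, Pi.single_eq_of_ne hk]) (fun k hk => hz.ne hk)
  have hbi := expSum_mul_coeff_mul_prod_erase_pos h0 hμ hb.ne_zero hx i (u := z i)
    (fun k hk => by rw [hb k, Pi.single_eq_of_ne hk]) (fun k hk => by
      have := hx.ne hk
      rwa [Function.update_of_ne hli.symm] at this)
  rw [ha i, Pi.single_eq_same, one_mul] at hai
  rw [hbz i hli.symm, Pi.single_eq_same, one_mul] at hbi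
  have hl : l ∈ Finset.univ.erase i := by simp [hli]
  have hi : i ∈ Finset.univ.erase l := by simp [hli.symm]
  have hcomm : (Finset.univ.erase l).erase i = (Finset.univ.erase i).erase l :=
    Finset.erase_right_comm
  rw [← Finset.mul_prod_erase _ _ hl] at haξ hai hbi
  rw [← Finset.mul_prod_erase _ _ hi, hcomm] at hdξ
  have hbi' : ∏ k ∈ (Finset.univ.erase i).erase l, (Function.update z l ξ k - z i) =
      ∏ k ∈ (Finset.univ.erase i).erase l, (z k - z i) :=
    Finset.prod_congr rfl fun k hk => by rw [Function.update_of_ne (Finset.ne_of_mem_erase hk)]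
  rw [hbi', Function.update_self] at hbi
  set P := ∏ k ∈ (Finset.univ.erase i).erase l, (z k - z i)
  set Q := ∏ k ∈ (Finset.univ.erase i).erase l, (z k - ξ)
  -- The sign formulas at `z i` differ only in the factor of node `l`, and `z l`, `ξ` lie on the
  -- same side of `z i`.
  have h1 : 0 < a 0 * b 0 := by
    have := mul_pos hai hbi
    have h2 : 0 < (z l - z i) * (ξ - z i) := by
      rcases hξ with h | h
      · exact mul_pos (by linarith) (by linarith)
      · exact mul_pos_of_neg_of_neg (by linarith) (by linarith)
    refine pos_of_mul_pos_left (b := (z l - z i) * (ξ - z i) * P ^ 2) ?_ (by positivity)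
    linarith
  -- The sign formulas for `a` and `a - b` at `ξ` are compared: `z l` and `z i` lie on the same side
  -- of `ξ`. With `h1`, `b 0` lies between `0` and `a 0`.
  have h3 : 0 < a 0 * (a 0 - b 0) := by
    have := mul_pos haξ hdξ
    have h2 : 0 < (z l - ξ) * (z i - ξ) := by
      rcases hξ with h | h
      · exact mul_pos_of_neg_of_neg (by linarith) (by linarith)
      · exact mul_pos (by linarith) (by linarith)
    refine pos_of_mul_pos_left (b := (z l - ξ) * (z i - ξ) * (Q * expSum μ a ξ) ^ 2) ?_
      (by positivity)
    linarith
  refine sq_le_sq.1 ?_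
  nlinarith

theorem IsLagrangeCoeff.abs_coeff_zero_le {n : ℕ} {μ : Fin (n + 1) → ℝ} (h0 : μ 0 = 0)
    (hμ : StrictMono μ) {z x : Fin (n + 1) → ℝ} (hz : Function.Injective z)
    (hx : Function.Injective x) {i : Fin (n + 1)} (hi : x i = z i)
    (hzx : ∀ l ≠ i, (z i < z l ∧ z l ≤ x l) ∨ (x l ≤ z l ∧ z l < z i)) {a b : Fin (n + 1) → ℝ}
    (ha : IsLagrangeCoeff μ z i a) (hb : IsLagrangeCoeff μ x i b) : |b 0| ≤ |a 0| := by
  induction hN : (Finset.univ.filter fun l => z l ≠ x l).card generalizing z a with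
  | zero =>
    have : z = x := by
      rw [Finset.card_eq_zero, Finset.filter_eq_empty_iff] at hN
      exact funext fun l => not_not.1 (hN (Finset.mem_univ l))
    subst this
    rw [expSum_ext hμ.injective hz fun k => (ha k).trans (hb k).symm]
  | succ N ih =>
    -- The node with the farthest target is moved first: a misplaced node already sitting on that
    -- target would itself have to move still farther out.
    obtain ⟨l, hl, hmax⟩ := Finset.exists_max_image (Finset.univ.filter fun l => z l ≠ x l)
      (fun l => |x l - z i|) (Finset.card_pos.1 (by omega))
    have hlx : z l ≠ x l := (Finset.mem_filter.1 hl).2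
    have hli : l ≠ i := by rintro rfl; exact hlx hi.symm
    have hne : ∀ m ≠ l, z m ≠ x l := by
      intro m hm h
      by_cases hmx : z m = x m
      · exact hm (hx (hmx ▸ h))
      have hmi : m ≠ i := by rintro rfl; exact hmx hi.symm
      have h1 := hmax m (by simp [hmx])
      have hzm := hzx m hmi
      rw [h] at hzm hmx
      rcases hzm with ⟨h2, h3⟩ | ⟨h2, h3⟩
      · rw [abs_of_pos (by linarith), abs_of_pos (by linarith)] at h1
        exact hmx (by linarith)
      · rw [abs_of_neg (by linarith), abs_of_neg (by linarith)] at h1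
        exact hmx (by linarith)
    have hinj : Function.Injective (Function.update z l (x l)) := by
      intro m k hmk
      by_cases hm : m = l <;> by_cases hk : k = l
      · rw [hm, hk]
      · subst hm
        rw [Function.update_self, Function.update_of_ne hk] at hmk
        exact absurd hmk.symm (hne k hk)
      · subst hk
        rw [Function.update_self, Function.update_of_ne hm] at hmk
        exact absurd hmk (hne m hm)
      · rw [Function.update_of_ne hm, Function.update_of_ne hk] at hmk
        exact hz hmk
    obtain ⟨c, hc⟩ := exists_expSum_interpolating hμ.injective hinj
      (Pi.single (M := fun _ => ℝ) i 1)
    have hzi : Function.update z l (x l) i = z i := Function.update_of_ne hli.symm _ _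
    refine (ih hinj (hzi ▸ hi) ?_ hc ?_).trans
      (ha.abs_coeff_zero_le_of_update h0 hμ hz hli hinj ?_ hc)
    · intro m hm
      rw [hzi]
      by_cases hml : m = l
      · subst hml
        rw [Function.update_self]
        rcases hzx m hm with h | h
        · exact Or.inl ⟨h.1.trans_le h.2, le_rfl⟩
        · exact Or.inr ⟨le_rfl, h.1.trans_lt h.2⟩
      · rw [Function.update_of_ne hml]
        exact hzx m hm
    · have : (Finset.univ.filter fun m => Function.update z l (x l) m ≠ x m) =
          (Finset.univ.filter fun m => z m ≠ x m).erase l := by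
        ext m
        by_cases hml : m = l
        · subst hml; simp
        · simp [hml]
      rw [this, Finset.card_erase_of_mem hl, hN, Nat.add_sub_cancel]
    · rcases hzx l hli with h | h
      · exact Or.inl ⟨h.1, h.2.lt_of_ne hlx⟩
      · exact Or.inr ⟨h.1.lt_of_ne hlx.symm, h.2⟩

/-- Spreading out the nodes decreases the constant coefficients of the Lagrange functions. -/
theorem IsLagrangeCoeff.abs_coeff_zero_le_of_gaps {n : ℕ} {μ : Fin (n + 1) → ℝ} (h0 : μ 0 = 0)
    (hμ : StrictMono μ) {y x : Fin (n + 1) → ℝ} (hy : Function.Injective y)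
    (hyx : ∀ k l, y k < y l → y l - y k ≤ x l - x k) {i : Fin (n + 1)} {a b : Fin (n + 1) → ℝ}
    (ha : IsLagrangeCoeff μ y i a) (hb : IsLagrangeCoeff μ x i b) : |b 0| ≤ |a 0| := by
  have hx : Function.Injective x := by
    intro k l hkl
    by_contra hne
    rcases lt_or_gt_of_ne (hy.ne hne) with h | h
    · have := hyx _ _ h; linarith
    · have := hyx _ _ h; linarith
  let δ := x i - y i
  -- Translating the nodes so that node `i` is fixed rescales the coefficients and leaves the
  -- constant one unchanged.
  let a' : Fin (n + 1) → ℝ := fun j => a j * Real.exp (-(μ j * δ))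
  have ha' : IsLagrangeCoeff μ (fun k => y k + δ) i a' := by
    intro k
    rw [← ha k]
    simp only [expSum, a', mul_assoc, ← Real.exp_add]
    refine Finset.sum_congr rfl fun j _ => ?_
    ring_nf
  have ha0 : a' 0 = a 0 := by simp [a', h0]
  rw [← ha0]
  refine ha'.abs_coeff_zero_le h0 hμ (fun k l h => hy (by simpa using h)) hx (by simp [δ]) ?_ hb
  intro l hl
  rcases lt_or_gt_of_ne (hy.ne hl) with h | h
  · have := hyx _ _ h
    exact Or.inr ⟨by simp only [δ]; linarith, by linarith⟩
  · have := hyx _ _ h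
    exact Or.inl ⟨by linarith, by simp only [δ]; linarith⟩

/-! ### Finitely supported measures and Carathéodory reduction -/

/-- The total variation of a finitely supported signed measure. -/
noncomputable def Finsupp.totalVariation (w : ℝ →₀ ℝ) : ℝ := ∑ t ∈ w.support, |w t|

theorem Finsupp.totalVariation_eq_sum {w : ℝ →₀ ℝ} {T : Finset ℝ} (h : w.support ⊆ T) :
    w.totalVariation = ∑ t ∈ T, |w t| :=
  Finset.sum_subset h fun t _ ht => by simp [Finsupp.notMem_support_iff.1 ht]

theorem Finsupp.totalVariation_smul_add_smul_le (r s : ℝ) (v w : ℝ →₀ ℝ) :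
    (r • v + s • w).totalVariation ≤ |r| * v.totalVariation + |s| * w.totalVariation := by
  rw [totalVariation_eq_sum (T := v.support ∪ w.support),
    totalVariation_eq_sum (w := v) Finset.subset_union_left,
    totalVariation_eq_sum (w := w) Finset.subset_union_right, Finset.mul_sum, Finset.mul_sum,
    ← Finset.sum_add_distrib]
  · refine Finset.sum_le_sum fun t _ => ?_
    simp only [Finsupp.add_apply, Finsupp.smul_apply, smul_eq_mul, ← abs_mul]
    exact abs_add_le _ _
  · intro t ht
    by_contra h
    simp only [Finset.mem_union, Finsupp.mem_support_iff, not_or, not_not] at h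
    simp [h] at ht

/-- A linear relation `g` among the vectors is subtracted from `w` until a first weight vanishes.
Until then the signs of the weights persist, so the total variation is affine along the way;
choosing the sign of `g` makes it nonincreasing. -/
theorem Finsupp.exists_reduce {V : Type*} [AddCommGroup V] [Module ℝ V] (v : ℝ → V) (w : ℝ →₀ ℝ)
    (hw : ¬ LinearIndepOn ℝ v (w.support : Set ℝ)) :
    ∃ w' : ℝ →₀ ℝ, w'.support ⊂ w.support ∧ w'.totalVariation ≤ w.totalVariation ∧
      linearCombination ℝ v w' = linearCombination ℝ v w := by
  rw [linearIndepOn_iff] at hw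
  push Not at hw
  let σ : ℝ → ℝ := fun t => if 0 < w t then 1 else -1
  have hex : ∃ g ∈ supported ℝ ℝ (w.support : Set ℝ), linearCombination ℝ v g = 0 ∧ g ≠ 0 ∧
      0 ≤ ∑ t ∈ w.support, σ t * g t := by
    obtain ⟨g, hg, hg0, hne⟩ := hw
    rcases le_total 0 (∑ t ∈ w.support, σ t * g t) with h | h
    · exact ⟨g, hg, hg0, hne, h⟩
    · exact ⟨-g, neg_mem hg, by simp [hg0], neg_ne_zero.2 hne, by simpa using h⟩
  obtain ⟨g, hg, hg0, hne, hsum⟩ := hex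
  have hgs : g.support ⊆ w.support := by
    exact_mod_cast (mem_supported ℝ g).1 hg
  have hσ : ∀ t ∈ w.support, 0 < σ t * w t := fun t ht => by
    have := Finsupp.mem_support_iff.1 ht
    simp only [σ]
    split_ifs with h
    · linarith
    · have := lt_of_le_of_ne (not_lt.1 h) this
      linarith
  have hσsq : ∀ t, σ t * σ t = 1 := fun t => by simp only [σ]; split_ifs <;> norm_num
  have hpos : (w.support.filter fun t => 0 < σ t * g t).Nonempty := by
    obtain ⟨t, ht⟩ := Finsupp.support_nonempty_iff.2 hne
    by_contra hemp
    rw [Finset.not_nonempty_iff_eq_empty, Finset.filter_eq_empty_iff] at hemp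
    have hle : ∀ t ∈ w.support, σ t * g t ≤ 0 := fun t ht => not_lt.1 (hemp ht)
    have h0 := (Finset.sum_eq_zero_iff_of_nonpos hle).1
      (le_antisymm (Finset.sum_nonpos hle) hsum) t (hgs ht)
    rcases mul_eq_zero.1 h0 with h | h
    · have := hσsq t; rw [h] at this; norm_num at this
    · exact Finsupp.mem_support_iff.1 ht h
  -- `t₀` is the first point whose weight reaches `0` along `w - τ • g`; only points where `g` has
  -- the sign of `w` compete.
  obtain ⟨t₀, ht₀, hmin⟩ := Finset.exists_min_image _ (fun t => w t / g t) hpos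
  obtain ⟨ht₀w, ht₀g⟩ := Finset.mem_filter.1 ht₀
  have hdiv : ∀ t, w t / g t = (σ t * w t) / (σ t * g t) := fun t => by
    have : σ t ≠ 0 := fun h => by have := hσsq t; rw [h] at this; norm_num at this
    rw [mul_div_mul_left _ _ this]
  set τ := w t₀ / g t₀ with hτ
  have hτ0 : 0 < τ := by rw [hτ, hdiv]; exact div_pos (hσ _ ht₀w) ht₀g
  have hsub : (w - τ • g).support ⊆ w.support.erase t₀ := by
    intro t ht
    refine Finset.mem_erase.2 ⟨?_, ?_⟩
    · rintro rfl
      have hgt : g t ≠ 0 := fun h => by simp [h] at ht₀g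
      refine Finsupp.mem_support_iff.1 ht ?_
      simp [hτ, hgt]
    · by_contra h
      have h1 := Finsupp.notMem_support_iff.1 h
      have h2 := Finsupp.notMem_support_iff.1 fun hh => h (hgs hh)
      exact Finsupp.mem_support_iff.1 ht (by simp [h1, h2])
  refine ⟨w - τ • g, lt_of_le_of_lt hsub (Finset.erase_ssubset ht₀w), ?_, by simp [hg0]⟩
  rw [totalVariation_eq_sum (hsub.trans (Finset.erase_subset _ _)), totalVariation]
  have hterm : ∀ t ∈ w.support, |(w - τ • g) t| ≤ |w t| - τ * (σ t * g t) := by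
    intro t ht
    have hσabs : |σ t| = 1 := by simp only [σ]; split_ifs <;> simp
    have e1 : |w t| = σ t * w t := by
      rw [← abs_of_pos (hσ t ht), abs_mul, hσabs, one_mul]
    have e2 : |(w - τ • g) t| = |σ t * w t - τ * (σ t * g t)| := by
      rw [show σ t * w t - τ * (σ t * g t) = σ t * (w t - τ * g t) by ring, abs_mul, hσabs]
      simp
    rw [e1, e2, abs_of_nonneg]
    rcases le_or_gt (σ t * g t) 0 with h | h
    · nlinarith [hσ t ht]
    · have := hmin t (Finset.mem_filter.2 ⟨ht, h⟩)
      rw [hdiv t, le_div_iff₀ h] at this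
      linarith
  calc _ ≤ ∑ t ∈ w.support, (|w t| - τ * (σ t * g t)) := Finset.sum_le_sum hterm
    _ = ∑ t ∈ w.support, |w t| - τ * ∑ t ∈ w.support, σ t * g t := by
      rw [Finset.sum_sub_distrib, Finset.mul_sum]
    _ ≤ _ := by nlinarith

theorem Finsupp.exists_linearIndepOn {V : Type*} [AddCommGroup V] [Module ℝ V] (v : ℝ → V)
    (w : ℝ →₀ ℝ) :
    ∃ w' : ℝ →₀ ℝ, w'.support ⊆ w.support ∧ w'.totalVariation ≤ w.totalVariation ∧
      linearCombination ℝ v w' = linearCombination ℝ v w ∧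
      LinearIndepOn ℝ v (w'.support : Set ℝ) := by
  induction hN : w.support.card using Nat.strong_induction_on generalizing w with
  | _ N ih =>
    by_cases hw : LinearIndepOn ℝ v (w.support : Set ℝ)
    · exact ⟨w, subset_rfl, le_rfl, rfl, hw⟩
    · obtain ⟨u, hu1, hu2, hu3⟩ := exists_reduce v w hw
      obtain ⟨u', h1, h2, h3, h4⟩ := ih _ (hN ▸ Finset.card_lt_card hu1) u rfl
      exact ⟨u', h1.trans hu1.subset, h2.trans hu2, h3.trans hu3, h4⟩

/-! ### Representing the constant coefficient by finitely many nodes -/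

section Nodes

variable {n : ℕ}

theorem dual_expVec (μ : Fin (n + 1) → ℝ) (f : (Fin (n + 1) → ℝ) →L[ℝ] ℝ) (t : ℝ) :
    f (fun j => Real.exp (μ j * t)) = expSum μ (fun j => f (Pi.single j 1)) t := by
  conv_lhs => rw [← Finset.univ_sum_single (fun j => Real.exp (μ j * t)), map_sum]
  refine Finset.sum_congr rfl fun j _ => ?_
  rw [show Pi.single (M := fun _ => ℝ) j (Real.exp (μ j * t)) =
    Real.exp (μ j * t) • Pi.single (M := fun _ => ℝ) j 1 by
      rw [← Pi.single_smul, smul_eq_mul, mul_one], map_smul, smul_eq_mul, mul_comm]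

/-- If the constant coefficient is a functional of norm at most `C` with respect to the uniform norm
on `I`, it is represented by a measure of total variation at most `C + 1` on finitely many
points of `I`. -/
theorem exists_finsupp_repr {μ : Fin (n + 1) → ℝ} (hμ : StrictMono μ) {I : Set ℝ}
    (hI : I.Infinite) {C : ℝ} (hC0 : 0 < C)
    (hC : ∀ a B, (∀ t ∈ I, |expSum μ a t| ≤ B) → a 0 ≤ C * B) :
    ∃ w : ℝ →₀ ℝ, (w.support : Set ℝ) ⊆ I ∧ w.totalVariation ≤ C + 1 ∧
      Finsupp.linearCombination ℝ (fun t j => Real.exp (μ j * t)) w =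
        Pi.single (M := fun _ : Fin (n + 1) => ℝ) 0 1 := by
  set v : ℝ → Fin (n + 1) → ℝ := fun t j => Real.exp (μ j * t) with hv
  let R : Set (Fin (n + 1) → ℝ) := {e | ∃ w : ℝ →₀ ℝ, w ∈ Finsupp.supported ℝ ℝ I ∧
    w.totalVariation ≤ C ∧ Finsupp.linearCombination ℝ v w = e}
  have hR : Convex ℝ R := by
    rintro _ ⟨w₁, hs₁, ht₁, rfl⟩ _ ⟨w₂, hs₂, ht₂, rfl⟩ r s hr hs hrs
    refine ⟨r • w₁ + s • w₂, add_mem (Submodule.smul_mem _ _ hs₁) (Submodule.smul_mem _ _ hs₂),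
      (Finsupp.totalVariation_smul_add_smul_le _ _ _ _).trans ?_, by simp⟩
    rw [abs_of_nonneg hr, abs_of_nonneg hs]
    nlinarith
  have hsingle : ∀ t ∈ I, ∀ r, |r| ≤ C → r • v t ∈ R := fun t ht r hr =>
    ⟨Finsupp.single t r, Finsupp.single_mem_supported ℝ _ ht, by
      rw [Finsupp.totalVariation_eq_sum (T := {t}) Finsupp.support_single_subset]; simpa using hr,
      by simp⟩
  -- A functional separating the target from `R` would be an exponential sum bounded by `u / C` on
  -- `I` with constant coefficient above `u`.
  have hclos : Pi.single (M := fun _ : Fin (n + 1) => ℝ) 0 1 ∈ closure R := by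
    by_contra hnot
    obtain ⟨f, u, hfu, hu⟩ := geometric_hahn_banach_closed_point hR.closure isClosed_closure hnot
    have hb : ∀ t ∈ I, |expSum μ (fun j => f (Pi.single j 1)) t| ≤ u / C := by
      intro t ht
      rw [← dual_expVec, le_div_iff₀ hC0, ← abs_of_pos hC0, ← abs_mul, abs_le']
      have h1 := hfu _ (subset_closure (hsingle t ht C (abs_of_pos hC0).le))
      have h2 := hfu _ (subset_closure (hsingle t ht (-C) (by rw [abs_neg, abs_of_pos hC0])))
      rw [map_smul, smul_eq_mul] at h1 h2
      simp only [hv] at h1 h2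
      constructor <;> linarith
    have := hC _ _ hb
    rw [mul_div_cancel₀ _ hC0.ne'] at this
    linarith
  -- Membership in the closure leaves a small defect. It is corrected exactly on `n + 1` fixed
  -- points, whose vectors form a basis, at the cost of total variation at most `1`.
  obtain ⟨Y, hYI, hYc⟩ := hI.exists_subset_card_eq (n + 1)
  let y : Fin (n + 1) → ℝ := Y.orderEmbOfFin hYc
  have hy : Function.Injective y := (Y.orderEmbOfFin hYc).injective
  have hyI : ∀ k, y k ∈ I := fun k => hYI (Y.orderEmbOfFin_mem hYc k)
  let L : (Fin (n + 1) → ℝ) →ₗ[ℝ] (Fin (n + 1) → ℝ) := Fintype.linearCombination ℝ fun k => v (y k)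
  have hL : Function.Surjective L := by
    have hdet : LinearIndependent ℝ fun k => v (y k) := by
      have hrow : IsUnit (Matrix.of fun k j => v (y k) j) := by
        rw [← Matrix.mulVec_injective_iff_isUnit, ← Matrix.coe_mulVecLin,
          injective_iff_map_eq_zero]
        intro a ha
        refine expSum_coeff_eq_zero hμ.injective a (Finset.univ.map ⟨y, hy⟩) (by simp) ?_
        intro t ht
        obtain ⟨k, -, rfl⟩ := Finset.mem_map.1 ht
        have := congrFun ha k
        simpa [Matrix.mulVec, dotProduct, expSum, hv, mul_comm] using this
      exact Matrix.linearIndependent_rows_iff_isUnit.2 hrow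
    have hinj : Function.Injective L := by
      rw [injective_iff_map_eq_zero]
      intro d hd
      exact funext (Fintype.linearIndependent_iff.1 hdet d hd)
    exact LinearMap.injective_iff_surjective.1 hinj
  obtain ⟨M, hM⟩ := L.exists_rightInverse_of_surjective (LinearMap.range_eq_top.2 hL)
  have hMc : Continuous fun e => ∑ k, |M e k| := by
    have := M.continuous_of_finiteDimensional
    fun_prop
  have hnear : ∀ᶠ e in nhds (Pi.single (M := fun _ : Fin (n + 1) => ℝ) 0 1),
      ∑ k, |M (Pi.single (M := fun _ : Fin (n + 1) => ℝ) 0 1 - e) k| < 1 := by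
    have hc : Continuous fun e =>
      ∑ k, |M (Pi.single (M := fun _ : Fin (n + 1) => ℝ) 0 1 - e) k| :=
        hMc.comp (continuous_const.sub continuous_id)
    refine hc.continuousAt.eventually_lt_const ?_
    simp
  obtain ⟨_, ⟨w, hwI, hwC, rfl⟩, hlt⟩ := (mem_closure_iff_frequently.1 hclos).and_eventually
    hnear |>.exists
  set e := Pi.single (M := fun _ : Fin (n + 1) => ℝ) 0 1 - Finsupp.linearCombination ℝ v w
  let d : ℝ →₀ ℝ := ∑ k, Finsupp.single (y k) (M e k)
  have hdI : d ∈ Finsupp.supported ℝ ℝ I :=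
    Submodule.sum_mem _ fun k _ => Finsupp.single_mem_supported ℝ _ (hyI k)
  have hdy : ∀ k, d (y k) = M e k := fun k => by
    simp only [d, Finsupp.finsetSum_apply, Finsupp.single_apply, hy.eq_iff]
    simp
  have hdTV : d.totalVariation ≤ 1 := by
    rw [Finsupp.totalVariation_eq_sum (T := Finset.univ.map ⟨y, hy⟩), Finset.sum_map]
    · simp only [Function.Embedding.coeFn_mk, hdy]
      exact hlt.le
    · intro t ht
      by_contra hnot
      refine Finsupp.mem_support_iff.1 ht ?_
      simp only [d, Finsupp.finsetSum_apply]
      refine Finset.sum_eq_zero fun k _ => Finsupp.single_eq_of_ne ?_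
      rintro rfl
      exact hnot (by simp)
  have hde : Finsupp.linearCombination ℝ v d = e := by
    have := LinearMap.congr_fun hM e
    simp only [d, map_sum, Finsupp.linearCombination_single]
    simpa [L, Fintype.linearCombination_apply] using this
  refine ⟨w + d, ?_, ?_, ?_⟩
  · exact_mod_cast (Finsupp.mem_supported ℝ _).1 (add_mem hwI hdI)
  · have := Finsupp.totalVariation_smul_add_smul_le 1 1 w d
    simp only [one_smul, abs_one, one_mul] at this
    linarith
  · rw [map_add, hde]; simp [e]

/-- A representation of the constant coefficient by exactly `n + 1` nodes. -/
theorem exists_nodes {μ : Fin (n + 1) → ℝ} (hμ : StrictMono μ) {I : Set ℝ}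
    (hI : I.Infinite) {C : ℝ} (hC0 : 0 < C)
    (hC : ∀ a B, (∀ t ∈ I, |expSum μ a t| ≤ B) → a 0 ≤ C * B) :
    ∃ y c : Fin (n + 1) → ℝ, Function.Injective y ∧ (∀ k, y k ∈ I) ∧
      (∀ a, a 0 = ∑ k, c k * expSum μ a (y k)) ∧ ∑ k, |c k| ≤ C + 1 := by
  obtain ⟨w₀, hw₀I, hw₀C, hw₀⟩ := exists_finsupp_repr hμ hI hC0 hC
  obtain ⟨w, hws, hwt, hwe, hwli⟩ := Finsupp.exists_linearIndepOn
    (fun t (j : Fin (n + 1)) => Real.exp (μ j * t)) w₀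
  rw [hw₀] at hwe
  have hcard : w.support.card ≤ n + 1 := by
    have := LinearIndependent.fintype_card_le_finrank hwli
    simpa using this
  have hwI : (w.support : Set ℝ) ⊆ I := fun t ht => hw₀I (hws ht)
  -- Independence in dimension `n + 1` bounds the support; points of weight `0` complete it to
  -- exactly `n + 1` nodes.
  obtain ⟨T, hwT, hTI, hTc⟩ : ∃ T : Finset ℝ, w.support ⊆ T ∧ (T : Set ℝ) ⊆ I ∧ T.card = n + 1 := by
    obtain ⟨U, hU, hUc⟩ := (hI.sdiff w.support.finite_toSet).exists_subset_card_eq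
      (n + 1 - w.support.card)
    have hdis : Disjoint w.support U :=
      Finset.disjoint_right.2 fun t ht h => (hU ht).2 h
    refine ⟨w.support ∪ U, Finset.subset_union_left, ?_, ?_⟩
    · rw [Finset.coe_union]
      exact Set.union_subset hwI fun t ht => (hU ht).1
    · rw [Finset.card_union_of_disjoint hdis, hUc]; omega
  let y := T.orderEmbOfFin hTc
  have hTy : T = Finset.univ.map y.toEmbedding := by
    rw [← Finset.coe_inj, Finset.coe_map, Finset.coe_univ, Set.image_univ]
    exact (T.range_orderEmbOfFin hTc).symm
  refine ⟨y, fun k => w (y k), y.injective, fun k => hTI (T.orderEmbOfFin_mem hTc k), fun a => ?_, ?_⟩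
  · have h1 : ∀ j, ∑ t ∈ T, w t * Real.exp (μ j * t) =
        Pi.single (M := fun _ : Fin (n + 1) => ℝ) 0 1 j := fun j => by
      rw [← hwe, Finsupp.linearCombination_apply, Finsupp.sum_of_support_subset _ hwT _ (by simp)]
      simp
    have h2 : ∑ t ∈ T, w t * expSum μ a t = a 0 := by
      simp only [expSum, Finset.mul_sum]
      rw [Finset.sum_comm]
      simp only [mul_left_comm _ (a _), ← Finset.mul_sum, h1]
      simp [Pi.single_apply]
    rw [← h2, hTy, Finset.sum_map]; rfl
  · have := (Finsupp.totalVariation_eq_sum hwT).symm.le.trans (hwt.trans hw₀C)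
    rw [hTy, Finset.sum_map] at this
    exact this

end Nodes

/-! ### Functions annihilating exponentials, with bounded mean square -/

/-- Bounded measurable functions vanishing outside `[c, d]`. -/
structure IsBoundedOnInterval (g : ℝ → ℝ) (c d : ℝ) : Prop where
  measurable : Measurable g
  bounded : ∃ B, ∀ t, |g t| ≤ B
  eq_zero : ∀ t, t ∉ Set.Icc c d → g t = 0

namespace IsBoundedOnInterval

variable {f g : ℝ → ℝ} {c d c' d' : ℝ}

theorem mono (hg : IsBoundedOnInterval g c d) (hc : c' ≤ c) (hd : d ≤ d') :
    IsBoundedOnInterval g c' d' :=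
  ⟨hg.measurable, hg.bounded, fun t ht => hg.eq_zero t fun h => ht ⟨hc.trans h.1, h.2.trans hd⟩⟩

theorem shift (hg : IsBoundedOnInterval g c d) (h : ℝ) :
    IsBoundedOnInterval (fun t => g (t + h)) (c - h) (d - h) := by
  obtain ⟨B, hB⟩ := hg.bounded
  refine ⟨hg.measurable.comp (measurable_id.add_const h), ⟨B, fun t => hB _⟩, fun t ht => ?_⟩
  refine hg.eq_zero _ fun hh => ht ⟨?_, ?_⟩
  · linarith [hh.1]
  · linarith [hh.2]

theorem const_mul (hg : IsBoundedOnInterval g c d) (r : ℝ) :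
    IsBoundedOnInterval (fun t => r * g t) c d := by
  obtain ⟨B, hB⟩ := hg.bounded
  refine ⟨hg.measurable.const_mul r, ⟨|r| * B, fun t => ?_⟩, fun t ht => by
    simp [hg.eq_zero t ht]⟩
  rw [abs_mul]
  exact mul_le_mul_of_nonneg_left (hB t) (abs_nonneg r)

theorem add (hf : IsBoundedOnInterval f c d) (hg : IsBoundedOnInterval g c d) :
    IsBoundedOnInterval (fun t => f t + g t) c d := by
  obtain ⟨A, hA⟩ := hf.bounded
  obtain ⟨B, hB⟩ := hg.bounded
  exact ⟨hf.measurable.add hg.measurable,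
    ⟨A + B, fun t => (abs_add_le _ _).trans (add_le_add (hA t) (hB t))⟩,
    fun t ht => by simp [hf.eq_zero t ht, hg.eq_zero t ht]⟩

theorem mul (hf : IsBoundedOnInterval f c d) (hg : IsBoundedOnInterval g c' d') :
    IsBoundedOnInterval (fun t => f t * g t) c d := by
  obtain ⟨A, hA⟩ := hf.bounded
  obtain ⟨B, hB⟩ := hg.bounded
  refine ⟨hf.measurable.mul hg.measurable, ⟨A * B, fun t => ?_⟩,
    fun t ht => by simp [hf.eq_zero t ht]⟩
  rw [abs_mul]
  exact mul_le_mul (hA t) (hB t) (abs_nonneg _) ((abs_nonneg _).trans (hA t))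

theorem integrable_mul (hg : IsBoundedOnInterval g c d) {p : ℝ → ℝ} (hp : Continuous p) :
    Integrable (fun t => g t * p t) := by
  obtain ⟨B, hB⟩ := hg.bounded
  have h1 : IntegrableOn (fun t => g t * p t) (Set.Icc c d) := by
    refine Integrable.bdd_mul (c := B) hp.continuousOn.integrableOn_Icc
      hg.measurable.aestronglyMeasurable (Eventually.of_forall fun t => hB t)
  rwa [integrableOn_iff_integrable_of_support_subset] at h1
  intro t ht
  by_contra hn
  exact ht (by simp [hg.eq_zero t hn])

theorem integrable (hg : IsBoundedOnInterval g c d) : Integrable g := by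
  simpa using hg.integrable_mul (continuous_const (y := (1 : ℝ)))

end IsBoundedOnInterval

/-- A combination of three translates, of integral mean `1`, that annihilates the exponential
`exp (μ t)` when `q = exp (-μ h)`. -/
noncomputable def annihilate (h q : ℝ) (g : ℝ → ℝ) (t : ℝ) : ℝ :=
  (2 * (1 - q))⁻¹ * (g (t + h + h) + ((1 - q) * g (t + h) + -q * g t))

theorem IsBoundedOnInterval.annihilate {g : ℝ → ℝ} {c d : ℝ} (hg : IsBoundedOnInterval g c d)
    {h : ℝ} (hh : 0 ≤ h) (q : ℝ) : IsBoundedOnInterval (annihilate h q g) (c - 2 * h) d :=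
  (((hg.shift h).shift h).mono (by linarith) (by linarith) |>.add
    (((hg.shift h).const_mul (1 - q)).mono (by linarith) (by linarith) |>.add
    ((hg.const_mul (-q)).mono (by linarith) le_rfl))).const_mul _

theorem integral_shift_mul_exp (g : ℝ → ℝ) (h ν : ℝ) :
    ∫ t, g (t + h) * Real.exp (ν * t) = Real.exp (-(ν * h)) * ∫ t, g t * Real.exp (ν * t) := by
  rw [← integral_add_right_eq_self (fun t => g t * Real.exp (ν * t)) h, ← integral_const_mul]
  refine integral_congr_ae (Eventually.of_forall fun t => ?_)
  simp only
  rw [mul_left_comm, ← Real.exp_add]; ring_nf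

/-- When tested against `exp (ν * t)`, translation by `h` multiplies by `z = exp (-(ν * h))`. The
three translates thus give `(z + 1) * (z - q) / (2 * (1 - q))`, which is `1` at `z = 1` and `0` at
`z = q`. -/
theorem integral_annihilate_mul_exp {g : ℝ → ℝ} {c d : ℝ} (hg : IsBoundedOnInterval g c d)
    (h q ν : ℝ) :
    ∫ t, annihilate h q g t * Real.exp (ν * t) =
      (2 * (1 - q))⁻¹ * ((Real.exp (-(ν * h)) + 1) * (Real.exp (-(ν * h)) - q)) *
        ∫ t, g t * Real.exp (ν * t) := by
  have hexp : Continuous fun t => Real.exp (ν * t) := by fun_prop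
  have i1 := ((hg.shift h).shift h).integrable_mul hexp
  have i2 := ((hg.shift h).integrable_mul hexp).const_mul (1 - q)
  have i3 := (hg.integrable_mul hexp).const_mul (-q)
  have e1 := integral_shift_mul_exp (fun t => g (t + h)) h ν
  rw [integral_shift_mul_exp] at e1
  calc _ = ∫ t, (2 * (1 - q))⁻¹ * (g (t + h + h) * Real.exp (ν * t) +
        ((1 - q) * (g (t + h) * Real.exp (ν * t)) + -q * (g t * Real.exp (ν * t)))) := by
        refine integral_congr_ae (Eventually.of_forall fun t => ?_)
        simp only [annihilate]; ring
    _ = (2 * (1 - q))⁻¹ * (Real.exp (-(ν * h)) * (Real.exp (-(ν * h)) *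
          ∫ t, g t * Real.exp (ν * t)) + ((1 - q) * (Real.exp (-(ν * h)) *
          ∫ t, g t * Real.exp (ν * t)) + -q * ∫ t, g t * Real.exp (ν * t))) := by
        rw [integral_const_mul, integral_add i1 (i2.fun_add i3), integral_add i2 i3,
          integral_const_mul, integral_const_mul, integral_shift_mul_exp, e1]
    _ = _ := by ring

theorem integral_annihilate {g : ℝ → ℝ} {c d : ℝ} (hg : IsBoundedOnInterval g c d)
    (h : ℝ) {q : ℝ} (hq : q ≠ 1) : ∫ t, annihilate h q g t = ∫ t, g t := by
  have := integral_annihilate_mul_exp hg h q 0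
  have h1 : 1 - q ≠ 0 := sub_ne_zero.2 hq.symm
  have h2 : (2 * (1 - q))⁻¹ * ((1 + 1) * (1 - q)) = 1 := by field_simp; norm_num
  simp only [zero_mul, neg_zero, Real.exp_zero, mul_one, h2, one_mul] at this
  exact this

/-- A crude bound, enough for the finitely many steps where `q` need not be `1 / 6`. -/
theorem integral_annihilate_sq_le {g : ℝ → ℝ} {c d : ℝ} (hg : IsBoundedOnInterval g c d)
    (h : ℝ) {q : ℝ} (hq0 : 0 < q) (hq1 : q < 1) :
    ∫ t, annihilate h q g t ^ 2 ≤ 9 * ((2 * (1 - q))⁻¹) ^ 2 * ∫ t, g t ^ 2 := by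
  have hs : ∀ {f : ℝ → ℝ} {c d : ℝ}, IsBoundedOnInterval f c d →
      Integrable (fun t => f t ^ 2) := fun hf => by
    simpa only [sq] using (hf.mul hf).integrable
  have i1 := hs ((hg.shift h).shift h)
  have i2 := hs (hg.shift h)
  have i3 := hs hg
  have e2 : ∫ t, g (t + h) ^ 2 = ∫ t, g t ^ 2 := integral_add_right_eq_self (fun t => g t ^ 2) h
  have e1 : ∫ t, g (t + h + h) ^ 2 = ∫ t, g t ^ 2 :=
    (integral_add_right_eq_self (fun t => g (t + h) ^ 2) h).trans e2
  calc _ ≤ ∫ t, 3 * ((2 * (1 - q))⁻¹) ^ 2 * (g (t + h + h) ^ 2 + (g (t + h) ^ 2 + g t ^ 2)) := by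
        refine integral_mono_of_nonneg (Eventually.of_forall fun t => sq_nonneg _)
          ((i1.add (i2.add i3)).const_mul _) (Eventually.of_forall fun t => ?_)
        simp only [annihilate, mul_pow]
        rw [mul_comm 3, mul_assoc]
        refine mul_le_mul_of_nonneg_left ?_ (sq_nonneg _)
        set x := g (t + h + h)
        set y := g (t + h)
        set z := g t
        have hy : ((1 - q) * y) ^ 2 ≤ y ^ 2 := by
          rw [mul_pow]; exact mul_le_of_le_one_left (sq_nonneg _) (by nlinarith)
        have hz : (-q * z) ^ 2 ≤ z ^ 2 := by
          rw [mul_pow]; exact mul_le_of_le_one_left (sq_nonneg _) (by nlinarith)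
        nlinarith [sq_nonneg (x - (1 - q) * y), sq_nonneg (x - -q * z),
          sq_nonneg ((1 - q) * y - -q * z)]
    _ = _ := by
        rw [integral_const_mul, integral_add i1 (i2.fun_add i3), integral_add i2 i3, e1, e2]; ring

/-- For `q = 1 / 6` the operator `annihilate h q` is a contraction in the mean square norm. -/
theorem integral_annihilate_one_sixth_sq_le {g : ℝ → ℝ} {c d : ℝ}
    (hg : IsBoundedOnInterval g c d) (h : ℝ) :
    ∫ t, annihilate h (1 / 6) g t ^ 2 ≤ ∫ t, g t ^ 2 := by
  have hs : ∀ {f : ℝ → ℝ} {c d : ℝ}, IsBoundedOnInterval f c d →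
      Integrable (fun t => f t ^ 2) := fun hf => by
    simpa only [sq] using (hf.mul hf).integrable
  have i1 := (hs ((hg.shift h).shift h)).const_mul (42 / 100)
  have i2 := (hs (hg.shift h)).const_mul (1 / 2)
  have i3 := (hs hg).const_mul (8 / 100)
  have i4 := (((hg.shift h).shift h).mul (hg.shift h)).integrable.const_mul (36 / 100)
  have i5 := ((hg.shift h).mul hg).integrable.const_mul (-36 / 100)
  have e2 : ∫ t, g (t + h) ^ 2 = ∫ t, g t ^ 2 := integral_add_right_eq_self (fun t => g t ^ 2) h
  have e1 : ∫ t, g (t + h + h) ^ 2 = ∫ t, g t ^ 2 :=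
    (integral_add_right_eq_self (fun t => g (t + h) ^ 2) h).trans e2
  have e4 : ∫ t, g (t + h + h) * g (t + h) = ∫ t, g (t + h) * g t :=
    integral_add_right_eq_self (fun t => g (t + h) * g t) h
  -- In Fourier terms, `|z + 1| * |z - q|` on the unit circle is largest at `z = 1` when `q ≤ 3 - 2
  -- * √2`, and `1 / 6` qualifies. Here this appears as a sum of squares: the majorant's square
  -- terms have total weight `1`, and its cross terms cancel after translation.
  calc _ ≤ ∫ t, (42 / 100 * g (t + h + h) ^ 2 + (1 / 2 * g (t + h) ^ 2 + (8 / 100 * g t ^ 2 +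
        (36 / 100 * (g (t + h + h) * g (t + h)) + -36 / 100 * (g (t + h) * g t))))) := by
        refine integral_mono_of_nonneg (Eventually.of_forall fun t => sq_nonneg _)
          (i1.add (i2.add (i3.add (i4.add i5)))) (Eventually.of_forall fun t => ?_)
        simp only [annihilate]
        norm_num
        nlinarith [sq_nonneg (g t - g (t + h)), sq_nonneg (g t - 2 * g (t + h) + g (t + h + h))]
    _ = _ := by
        rw [integral_add i1 (i2.fun_add (i3.fun_add (i4.fun_add i5))),
          integral_add i2 (i3.fun_add (i4.fun_add i5)), integral_add i3 (i4.fun_add i5), integral_add i4 i5, integral_const_mul, integral_const_mul,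
          integral_const_mul, integral_const_mul, integral_const_mul, e1, e2, e4]
        ring

/-- The tail choice `log 6 / μ j` gives `q = 1 / 6`, and summability of `1 / μ j` keeps the total
enlargement of the support small. -/
theorem exists_steps {μ : ℕ → ℝ} (hμ : ∀ j, 0 < μ j) (hsum : Summable fun j => 1 / μ j) {ε : ℝ}
    (hε : 0 < ε) :
    ∃ h : ℕ → ℝ, (∀ j, 0 < h j) ∧ (∃ N, ∀ j ≥ N, Real.exp (-(μ j * h j)) = 1 / 6) ∧
      ∀ m, ∑ j ∈ Finset.range m, 2 * h j ≤ ε := by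
  have hlog : 0 < Real.log 6 := Real.log_pos (by norm_num)
  have hs : Summable fun j => 2 * (Real.log 6 / μ j) := by
    have := hsum.mul_left (2 * Real.log 6)
    refine this.congr fun j => by ring
  obtain ⟨N, hN⟩ := (((tendsto_sum_nat_add fun j => 2 * (Real.log 6 / μ j)).eventually_lt_const
    (half_pos hε))).exists
  -- The `N` initial steps use at most half of `ε`, and `N` was chosen so that the tail uses less
  -- than the other half.
  let h : ℕ → ℝ := fun j => if j < N then ε / (4 * (N + 1)) else Real.log 6 / μ j
  have hpos : ∀ j, 0 < h j := fun j => by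
    simp only [h]
    split_ifs
    · positivity
    · exact div_pos hlog (hμ j)
  refine ⟨h, hpos, ⟨N, fun j hj => ?_⟩, fun m => ?_⟩
  · simp only [h, if_neg (not_lt.2 hj)]
    rw [mul_div_cancel₀ _ (hμ j).ne', Real.exp_neg, Real.exp_log (by norm_num)]; norm_num
  · have hm : ∑ j ∈ Finset.range m, 2 * h j ≤ ∑ j ∈ Finset.range (N + m), 2 * h j :=
      Finset.sum_le_sum_of_subset_of_nonneg (Finset.range_mono (by omega))
        fun j _ _ => by have := hpos j; positivity
    rw [Finset.sum_range_add] at hm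
    have h1 : ∑ j ∈ Finset.range N, 2 * h j ≤ ε / 2 := by
      have : ∀ j ∈ Finset.range N, 2 * h j = ε / (2 * (N + 1)) := fun j hj => by
        simp only [h, if_pos (Finset.mem_range.1 hj)]; field_simp; norm_num
      rw [Finset.sum_congr rfl this, Finset.sum_const, Finset.card_range, nsmul_eq_mul,
        mul_div_assoc', div_le_div_iff₀ (by positivity) (by norm_num)]
      nlinarith
    have h2 : ∑ j ∈ Finset.range m, 2 * h (N + j) ≤ ε / 2 := by
      refine le_trans ?_ hN.le
      have hs' := (summable_nat_add_iff N).2 hs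
      refine le_trans (le_of_eq ?_) (hs'.sum_le_tsum (Finset.range m)
        fun j _ => by have := hμ (j + N); positivity)
      refine Finset.sum_congr rfl fun j _ => ?_
      simp only [h]
      rw [if_neg (by omega), add_comm]
    linarith

theorem exists_annihilating_functions {μ : ℕ → ℝ} (hμ : ∀ j, 0 < μ j)
    (hsum : Summable fun j => 1 / μ j) {c d : ℝ} (hcd : c < d) :
    ∃ K, ∀ m : ℕ, ∃ g, IsBoundedOnInterval g c d ∧ ∫ t, g t = 1 ∧
      (∀ j < m, ∫ t, g t * Real.exp (μ j * t) = 0) ∧ ∫ t, g t ^ 2 ≤ K := by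
  obtain ⟨h, hpos, ⟨N, hN⟩, hh⟩ := exists_steps hμ hsum (half_pos (sub_pos.2 hcd))
  let q : ℕ → ℝ := fun j => Real.exp (-(μ j * h j))
  have hq0 : ∀ j, 0 < q j := fun j => Real.exp_pos _
  have hq1 : ∀ j, q j < 1 := fun j => by
    have := mul_pos (hμ j) (hpos j)
    exact Real.exp_lt_one_iff.2 (by linarith)
  -- Only the steps before `N` can increase the mean square, so the product of the `κ j` is bounded
  -- independently of `m`.
  let κ : ℕ → ℝ := fun j => if j < N then max 1 (9 * ((2 * (1 - q j))⁻¹) ^ 2) else 1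
  have hκ1 : ∀ j, 1 ≤ κ j := fun j => by
    simp only [κ]; split_ifs
    exacts [le_max_left _ _, le_rfl]
  have hstep : ∀ j g c d, IsBoundedOnInterval g c d →
      ∫ t, annihilate (h j) (q j) g t ^ 2 ≤ κ j * ∫ t, g t ^ 2 := by
    intro j g c d hg
    simp only [κ]
    split_ifs with hj
    · refine (integral_annihilate_sq_le hg (h j) (hq0 j) (hq1 j)).trans ?_
      exact mul_le_mul_of_nonneg_right (le_max_right _ _) (integral_nonneg fun t => sq_nonneg _)
    · simp only [q, hN j (not_lt.1 hj), one_mul]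
      exact integral_annihilate_one_sixth_sq_le hg (h j)
  have hmono : Monotone fun m => ∏ j ∈ Finset.range m, κ j := monotone_nat_of_le_succ fun m => by
    rw [Finset.prod_range_succ]
    exact le_mul_of_one_le_right (Finset.prod_nonneg fun j _ => zero_le_one.trans (hκ1 j)) (hκ1 m)
  have hprod : ∀ m, ∏ j ∈ Finset.range m, κ j ≤ ∏ j ∈ Finset.range N, κ j := by
    intro m
    have h1 : ∏ j ∈ Finset.range m, κ j ≤ ∏ j ∈ Finset.range (N + m), κ j :=
      hmono (by omega)
    rw [Finset.prod_range_add] at h1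
    have h2 : ∏ j ∈ Finset.range m, κ (N + j) = 1 :=
      Finset.prod_eq_one fun j _ => if_neg (by omega)
    rwa [h2, mul_one] at h1
  -- The start is supported in the right half of `[c, d]`: each step extends the support to the
  -- left, by at most `(d - c) / 2` in total.
  let ρ : ℝ → ℝ := Set.indicator (Set.Icc ((c + d) / 2) d) fun _ => 2 / (d - c)
  have hρ : IsBoundedOnInterval ρ ((c + d) / 2) d := by
    refine ⟨measurable_const.indicator measurableSet_Icc, ⟨|2 / (d - c)|, fun t => ?_⟩,
      fun t ht => Set.indicator_of_notMem ht _⟩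
    simp only [ρ, Set.indicator]
    split_ifs
    · exact le_rfl
    · simp
  have hρ1 : ∫ t, ρ t = 1 := by
    have : 0 < d - c := sub_pos.2 hcd
    simp only [ρ]
    rw [integral_indicator measurableSet_Icc, setIntegral_const, Real.volume_real_Icc_of_le
      (by linarith), smul_eq_mul]
    field_simp; ring
  have key : ∀ m : ℕ, ∃ g, IsBoundedOnInterval g ((c + d) / 2 - ∑ j ∈ Finset.range m, 2 * h j) d ∧
      ∫ t, g t = 1 ∧ (∀ j < m, ∫ t, g t * Real.exp (μ j * t) = 0) ∧
      ∫ t, g t ^ 2 ≤ (∏ j ∈ Finset.range m, κ j) * ∫ t, ρ t ^ 2 := by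
    intro m
    induction m with
    | zero => exact ⟨ρ, by simpa using hρ, hρ1, by simp, by simp⟩
    | succ m ih =>
      obtain ⟨g, hg, hg1, hg0, hg2⟩ := ih
      refine ⟨annihilate (h m) (q m) g, ?_, ?_, fun j hj => ?_, ?_⟩
      · rw [Finset.sum_range_succ, ← sub_sub]
        exact hg.annihilate (hpos m).le _
      · rw [integral_annihilate hg _ (hq1 m).ne, hg1]
      · rw [integral_annihilate_mul_exp hg]
        rcases Nat.lt_succ_iff_lt_or_eq.1 hj with hj | rfl
        · rw [hg0 j hj, mul_zero]
        · simp [q]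
      · refine (hstep m g _ _ hg).trans ?_
        rw [Finset.prod_range_succ, mul_comm _ (κ m), mul_assoc]
        exact mul_le_mul_of_nonneg_left hg2 (zero_le_one.trans (hκ1 m))
  refine ⟨(∏ j ∈ Finset.range N, κ j) * ∫ t, ρ t ^ 2, fun m => ?_⟩
  obtain ⟨g, hg, hg1, hg0, hg2⟩ := key m
  refine ⟨g, hg.mono ?_ le_rfl, hg1, hg0, hg2.trans ?_⟩
  · have := hh m; linarith
  · exact mul_le_mul_of_nonneg_right (hprod m) (integral_nonneg fun t => sq_nonneg _)

/-! ### Bounds for the constant coefficient -/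

/-- On an interval, the constant coefficient of an exponential sum is controlled by the uniform norm,
with a constant that does not depend on the number of terms. -/
theorem exists_coeff_zero_le_interval {μ : ℕ → ℝ} (h0 : μ 0 = 0) (hμ : StrictMono μ)
    (hsum : Summable fun j => 1 / μ (j + 1)) {c d : ℝ} (hcd : c < d) :
    ∃ C, 0 < C ∧ ∀ (n : ℕ) (a : Fin (n + 1) → ℝ) (B : ℝ),
      (∀ t ∈ Set.Icc c d, |expSum (fun j => μ j) a t| ≤ B) → a 0 ≤ C * B := by
  have hpos : ∀ j, 0 < μ (j + 1) := fun j => h0 ▸ hμ (Nat.succ_pos j)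
  obtain ⟨K, hK⟩ := exists_annihilating_functions hpos hsum hcd
  have hK0 : 0 ≤ K := by
    obtain ⟨g, -, -, -, h⟩ := hK 0
    exact (integral_nonneg fun t => sq_nonneg _).trans h
  -- The constant comes from integrating `|g| ≤ (1 + g ^ 2) / 2` over `[c, d]`.
  refine ⟨((d - c) + K) / 2, by linarith, fun n a B hB => ?_⟩
  obtain ⟨g, hg, hg1, hg0, hg2⟩ := hK n
  have hB0 : 0 ≤ B := (abs_nonneg _).trans (hB c ⟨le_rfl, hcd.le⟩)
  have hval : ∫ t, g t * expSum (fun j => μ j) a t = a 0 := by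
    simp only [expSum, Finset.mul_sum]
    rw [integral_finsetSum _ fun j _ => ?_]
    · simp only [mul_left_comm (g _), integral_const_mul]
      rw [Fin.sum_univ_succ, Finset.sum_eq_zero, add_zero]
      · simp [h0, hg1]
      · intro j _
        have := hg0 j j.2
        simp only [Fin.val_succ, this, mul_zero]
    · exact hg.integrable_mul (by fun_prop)
  have hcont : Continuous (expSum (fun j : Fin (n + 1) => μ j) a) :=
    continuous_iff_continuousAt.2 fun t => (hasDerivAt_expSum _ _ t).continuousAt
  have hi1 : Integrable (Set.indicator (Set.Icc c d) fun _ => (1 : ℝ)) :=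
    continuousOn_const.integrableOn_Icc.integrable_indicator measurableSet_Icc
  have hi2 : Integrable fun t => g t ^ 2 := by simpa only [sq] using (hg.mul hg).integrable
  calc a 0 = ∫ t, g t * expSum (fun j => μ j) a t := hval.symm
    _ ≤ ∫ t, B / 2 * (Set.indicator (Set.Icc c d) (fun _ => (1 : ℝ)) t + g t ^ 2) := by
        refine integral_mono (hg.integrable_mul hcont) ((hi1.add hi2).const_mul _) fun t => ?_
        by_cases ht : t ∈ Set.Icc c d
        · simp only [Set.indicator_of_mem ht]
          have h1 := (le_abs_self (g t * expSum (fun j => μ j) a t))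
          rw [abs_mul] at h1
          have h2 := mul_le_mul_of_nonneg_left (hB t ht) (abs_nonneg (g t))
          have h3 : |g t| ≤ (1 + g t ^ 2) / 2 := by
            nlinarith [sq_nonneg (|g t| - 1), sq_abs (g t)]
          nlinarith [mul_le_mul_of_nonneg_left h3 hB0]
        · simp [Set.indicator_of_notMem ht, hg.eq_zero t ht]
    _ = B / 2 * ((d - c) + ∫ t, g t ^ 2) := by
        rw [integral_const_mul, integral_add hi1 hi2, integral_indicator measurableSet_Icc,
          setIntegral_const, Real.volume_real_Icc_of_le hcd.le, smul_eq_mul, mul_one]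
    _ ≤ _ := by nlinarith

/-- A compact set is parametrized, on `(0, |E|]`, by the measure of its initial segments. This
parametrization does not decrease distances. -/
theorem IsCompact.exists_expanding_parametrization {E : Set ℝ} (hE : IsCompact E) :
    ∃ φ : ℝ → ℝ, (∀ y, 0 < y → y ≤ volume.real E → φ y ∈ E) ∧
      ∀ y y', 0 < y → y < y' → y' ≤ volume.real E → y' - y ≤ φ y' - φ y := by
  have hfin : ∀ t, volume (E ∩ Set.Iic t) ≠ ⊤ := fun t =>
    ((measure_mono Set.inter_subset_left).trans_lt hE.measure_lt_top).ne
  let F : ℝ → ℝ := fun t => volume.real (E ∩ Set.Iic t)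
  have hmono : Monotone F := fun s t hst =>
    measureReal_mono (Set.inter_subset_inter_right _ (Set.Iic_subset_Iic.2 hst)) (hfin t)
  have hinc : ∀ s t, s ≤ t → F t ≤ F s + (t - s) := fun s t hst => by
    have hsub : E ∩ Set.Iic t ⊆ (E ∩ Set.Iic s) ∪ Set.Ioc s t := fun u hu => by
      rcases le_or_gt u s with h | h
      exacts [Or.inl ⟨hu.1, h⟩, Or.inr ⟨h, hu.2⟩]
    calc F t ≤ volume.real ((E ∩ Set.Iic s) ∪ Set.Ioc s t) := measureReal_mono hsub
          (measure_union_ne_top (hfin s) measure_Ioc_lt_top.ne)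
      _ ≤ F s + volume.real (Set.Ioc s t) := measureReal_union_le _ _
      _ = _ := by rw [Real.volume_real_Ioc_of_le hst]
  have hcont : Continuous F := by
    refine (LipschitzWith.of_dist_le_mul (K := 1) fun s t => ?_).continuous
    rw [Real.dist_eq, Real.dist_eq, NNReal.coe_one, one_mul]
    rcases le_total s t with h | h
    · rw [abs_sub_comm, abs_sub_comm s, abs_of_nonneg (sub_nonneg.2 (hmono h)),
        abs_of_nonneg (sub_nonneg.2 h)]
      linarith [hinc s t h]
    · rw [abs_of_nonneg (sub_nonneg.2 (hmono h)), abs_of_nonneg (sub_nonneg.2 h)]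
      linarith [hinc t s h]
  have hex : ∀ y, 0 < y → y ≤ volume.real E → ∃ t ∈ E, F t = y := by
    intro y hy hyE
    obtain ⟨α, hα⟩ := hE.bddBelow
    obtain ⟨β, hβ⟩ := hE.bddAbove
    have h1 : F (α - 1) = 0 := by
      have : E ∩ Set.Iic (α - 1) = ∅ := Set.eq_empty_of_forall_notMem fun u hu => by
        have := hα hu.1
        have := Set.mem_Iic.1 hu.2
        linarith
      simp [F, this]
    have h2 : F β = volume.real E := by
      have : E ∩ Set.Iic β = E := Set.inter_eq_left.2 fun u hu => Set.mem_Iic.2 (hβ hu)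
      simp only [F, this]
    obtain ⟨t, ht⟩ := mem_range_of_exists_le_of_exists_ge hcont ⟨α - 1, h1.trans_le hy.le⟩
      ⟨β, hyE.trans h2.ge⟩
    have hne : (E ∩ Set.Iic t).Nonempty := by
      rw [Set.nonempty_iff_ne_empty]
      intro h
      simp only [F, h, measureReal_empty] at ht
      exact hy.ne ht
    -- The point `t` may lie outside `E`; the last point of `E` up to `t` gives the same value of
    -- `F`.
    obtain ⟨u, hu, hmax⟩ := (hE.inter_right isClosed_Iic).exists_isGreatest hne
    refine ⟨u, hu.1, ?_⟩
    rw [← ht]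
    simp only [F]
    congr 1
    ext v
    exact ⟨fun hv => ⟨hv.1, (Set.mem_Iic.1 hv.2).trans (Set.mem_Iic.1 hu.2)⟩,
      fun hv => ⟨hv.1, hmax hv⟩⟩
  -- `F` is `1`-Lipschitz, so its right inverse `φ` cannot bring points closer together.
  choose! φ hφE hφ using hex
  refine ⟨φ, hφE, fun y y' hy hyy' hy' => ?_⟩
  have e1 := hφ y hy (hyy'.le.trans hy')
  have e2 := hφ y' (hy.trans hyy') hy'
  have hlt : φ y ≤ φ y' := by
    by_contra h
    have := hmono (not_le.1 h).le
    linarith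
  have := hinc _ _ hlt
  linarith

/-- A bounded Remez-type inequality for the constant coefficient, on compact sets of positive
measure. -/
theorem exists_coeff_zero_le_compact {μ : ℕ → ℝ} (h0 : μ 0 = 0) (hμ : StrictMono μ)
    (hsum : Summable fun j => 1 / μ (j + 1)) {E : Set ℝ} (hE : IsCompact E) (hpos : 0 < volume E) :
    ∃ C, 0 < C ∧ ∀ (n : ℕ) (a : Fin (n + 1) → ℝ) (B : ℝ),
      (∀ t ∈ E, |expSum (fun j => μ j) a t| ≤ B) → |a 0| ≤ C * B := by
  have hs : 0 < volume.real E := ENNReal.toReal_pos hpos.ne' hE.measure_lt_top.ne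
  obtain ⟨φ, hφE, hφ⟩ := hE.exists_expanding_parametrization
  -- The nodes stay in `[|E| / 2, |E|]` because `φ` is controlled only at positive arguments.
  have hcd : volume.real E / 2 < volume.real E := half_lt_self hs
  obtain ⟨C, hC0, hC⟩ := exists_coeff_zero_le_interval h0 hμ hsum hcd
  refine ⟨C + 1, by linarith, fun n a B hB => ?_⟩
  have hμn : StrictMono fun j : Fin (n + 1) => μ j := fun i j hij => hμ hij
  have hμ0 : (fun j : Fin (n + 1) => μ j) 0 = 0 := h0
  obtain ⟨y, c, hy, hyI, hc, hcC⟩ := exists_nodes hμn (Set.Icc_infinite hcd) hC0 (hC n)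
  have hy0 : ∀ k, 0 < y k := fun k => (half_pos hs).trans_le (hyI k).1
  have hgap : ∀ k l, y k < y l → y l - y k ≤ φ (y l) - φ (y k) := fun k l hkl =>
    hφ _ _ (hy0 k) hkl (hyI l).2
  have hx : Function.Injective fun k => φ (y k) := by
    intro k l hkl
    by_contra hne
    simp only at hkl
    rcases lt_or_gt_of_ne (hy.ne hne) with h | h
    · have := hgap _ _ h; linarith
    · have := hgap _ _ h; linarith
  choose e he using fun k => exists_expSum_interpolating hμn.injective hy
    (Pi.single (M := fun _ => ℝ) k 1)
  choose b hb using fun k => exists_expSum_interpolating hμn.injective hx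
    (Pi.single (M := fun _ => ℝ) k 1)
  -- Applying the node formula to the `k`-th Lagrange function identifies its weight.
  have hce : ∀ k, e k 0 = c k := fun k => by
    rw [hc (e k)]
    simp only [he]
    simp [Pi.single_apply]
  have hbc : ∀ k, |b k 0| ≤ |c k| := fun k => by
    rw [← hce]
    exact IsLagrangeCoeff.abs_coeff_zero_le_of_gaps hμ0 hμn hy hgap (he k) (hb k)
  have ha : a = fun j => ∑ k, expSum (fun j => μ j) a (φ (y k)) * b k j := by
    refine expSum_ext hμn.injective hx fun l => ?_
    have : expSum (fun j : Fin (n + 1) => μ j)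
        (fun j => ∑ k, expSum (fun j => μ j) a (φ (y k)) * b k j) (φ (y l)) =
        ∑ k, expSum (fun j => μ j) a (φ (y k)) * expSum (fun j => μ j) (b k) (φ (y l)) := by
      simp only [expSum, Finset.mul_sum, Finset.sum_mul]
      rw [Finset.sum_comm]
      simp only [mul_assoc]
    rw [this]
    simp only [hb]
    simp [Pi.single_apply]
  have ha0 : a 0 = ∑ k, expSum (fun j => μ j) a (φ (y k)) * b k 0 := congrFun ha 0
  have hB0 : 0 ≤ B := (abs_nonneg _).trans (hB _ (hφE _ (hy0 0) (hyI 0).2))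
  calc |a 0| = |∑ k, expSum (fun j => μ j) a (φ (y k)) * b k 0| := by rw [← ha0]
    _ ≤ ∑ k, |expSum (fun j => μ j) a (φ (y k)) * b k 0| := Finset.abs_sum_le_sum_abs _ _
    _ ≤ ∑ k, B * |c k| := Finset.sum_le_sum fun k _ => by
        rw [abs_mul]
        exact mul_le_mul (hB _ (hφE _ (hy0 k) (hyI k).2)) (hbc k) (abs_nonneg _) hB0
    _ = B * ∑ k, |c k| := by rw [Finset.mul_sum]
    _ ≤ (C + 1) * B := by nlinarith

/-! ### Convergent sum: failure of density -/

theorem exists_pos_measure_inter_Ici {A : Set ℝ} (hA0 : A ⊆ Set.Ici 0) (hpos : 0 < volume A) :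
    ∃ ε, 0 < ε ∧ 0 < volume (A ∩ Set.Ici ε) := by
  by_contra! h
  have hsub : A ⊆ {0} ∪ ⋃ n : ℕ, A ∩ Set.Ici (1 / ((n : ℝ) + 1)) := by
    intro x hx
    rcases (Set.mem_Ici.1 (hA0 hx)).eq_or_lt with h0 | h0
    · exact Or.inl h0.symm
    · obtain ⟨n, hn⟩ := exists_nat_one_div_lt h0
      exact Or.inr (Set.mem_iUnion.2 ⟨n, hx, hn.le⟩)
  have hnull : volume ({0} ∪ ⋃ n : ℕ, A ∩ Set.Ici (1 / ((n : ℝ) + 1))) = 0 :=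
    measure_union_null (by simp) (measure_iUnion_null fun n => le_antisymm (h _ (by positivity))
      zero_le)
  exact hpos.ne' (measure_mono_null hsub hnull)

theorem muntzSpace.exists_eq_sum {A : Set ℝ} {lam : ℕ → ℝ} {h : IsMuntzSequence lam}
    {p : C(A, ℝ)} (hp : p ∈ muntzSpace A lam h) :
    ∃ (n : ℕ) (c : ℕ → ℝ), ∀ x : A, p x = ∑ i : Fin n, c i * (x : ℝ) ^ lam i := by
  obtain ⟨c, rfl⟩ := Finsupp.mem_span_range_iff_exists_finsupp.1 hp
  obtain ⟨n, hn⟩ := c.support.exists_nat_subset_range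
  refine ⟨n, c, fun x => ?_⟩
  rw [Finsupp.sum_of_support_subset _ hn _ (by simp), ContinuousMap.sum_apply,
    Finset.sum_range]
  rfl

theorem not_dense_muntzSpace {lam : ℕ → ℝ} (hlam : IsMuntzSequence lam)
    {A : Set ℝ} (hA : IsCompact A) (hA0 : A ⊆ Set.Ici 0) (hpos : 0 < volume A)
    (hsum : Summable fun i => 1 / lam (i + 1)) :
    ¬ Dense (muntzSpace A lam hlam : Set C(A, ℝ)) := by
  intro hdense
  have hcomp : CompactSpace A := isCompact_iff_compactSpace.1 hA
  obtain ⟨ε, hε, hAε⟩ := exists_pos_measure_inter_Ici hA0 hpos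
  obtain ⟨b, hb⟩ := hA.bddAbove
  set D := A ∩ Set.Ici ε with hD
  have hDpos : ∀ x ∈ D, 0 < x := fun x hx => hε.trans_le hx.2
  have hE : IsCompact (Real.log '' D) :=
    (hA.inter_right isClosed_Ici).image_of_continuousOn
      (Real.continuousOn_log.mono fun x hx => (hDpos x hx).ne')
  have hEpos : 0 < volume (Real.log '' D) := by
    refine pos_iff_ne_zero.2 fun h => hAε.ne' ?_
    have himg : Real.exp '' (Real.log '' D) = D := by
      rw [Set.image_image]
      refine (Set.image_congr fun x hx => Real.exp_log (hDpos x hx)).trans ?_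
      simp
    rw [← himg]
    exact addHaar_image_eq_zero_of_differentiableOn_of_addHaar_eq_zero volume
      Real.differentiable_exp.differentiableOn h
  -- Multiplication by `x` raises every exponent by `1` and frees exponent `0` for the target `1 /
  -- x`.
  let μ : ℕ → ℝ := fun j => Nat.casesOn j 0 fun i => lam i + 1
  have hμ : StrictMono μ := strictMono_nat_of_lt_succ fun j => by
    cases j with
    | zero => exact add_pos_of_nonneg_of_pos (hlam.nonneg 0) one_pos
    | succ j => exact add_lt_add_left (hlam.strictMono (Nat.lt_succ_self j)) 1
  have hpos' : ∀ i, 0 < lam (i + 1) := fun i => hlam.zero ▸ hlam.strictMono (Nat.succ_pos i)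
  have hsum' : Summable fun j => 1 / μ (j + 1) := by
    rw [← summable_nat_add_iff 1]
    refine Summable.of_nonneg_of_le (fun i => ?_) (fun i => ?_) hsum
    · have := hpos' i
      simp only [μ]; positivity
    · simp only [μ]
      exact one_div_le_one_div_of_le (hpos' i) (by linarith)
  obtain ⟨C, hC0, hC⟩ := exists_coeff_zero_le_compact (μ := μ) rfl hμ hsum' hE hEpos
  have hb0 : 0 < b := by
    obtain ⟨x, hx⟩ := nonempty_of_measure_ne_zero hAε.ne'
    exact (hDpos x hx).trans_le (hb hx.1)
  -- The truncation makes `1 / x` continuous on all of `A` without changing it on `D`.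
  let f : C(A, ℝ) := ⟨fun x => (max (x : ℝ) ε)⁻¹,
    (continuous_subtype_val.max continuous_const).inv₀ fun x => (lt_max_of_lt_right hε).ne'⟩
  -- Since `x ≤ b`, this accuracy bounds the exponential sum by `1 / (2 * C)`, whence its constant
  -- coefficient `1` would be at most `1 / 2`.
  have hδ : 0 < 1 / (2 * C * b) := by positivity
  obtain ⟨p, hp, hfp⟩ := Metric.dense_iff.1 hdense f _ hδ
  rw [Metric.mem_ball, dist_comm] at hp
  obtain ⟨n, c, hc⟩ := muntzSpace.exists_eq_sum hfp
  let a : Fin (n + 1) → ℝ := Fin.cons 1 fun i => -c i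
  have hbound : ∀ t ∈ Real.log '' D, |expSum (fun j : Fin (n + 1) => μ j) a t| ≤ 1 / (2 * C) := by
    rintro _ ⟨x, hx, rfl⟩
    have hx0 := hDpos x hx
    have hval : expSum (fun j : Fin (n + 1) => μ j) a (Real.log x) =
        x * (f ⟨x, hx.1⟩ - p ⟨x, hx.1⟩) := by
      have hf : f ⟨x, hx.1⟩ = x⁻¹ := by
        simp only [f, ContinuousMap.coe_mk]
        rw [max_eq_left (Set.mem_Ici.1 hx.2)]
      rw [hf, hc, mul_sub, mul_inv_cancel₀ hx0.ne', Finset.mul_sum, expSum, Fin.sum_univ_succ,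
        sub_eq_add_neg, ← Finset.sum_neg_distrib]
      congr 1
      · simp [a, μ]
      · refine Finset.sum_congr rfl fun i _ => ?_
        simp only [a, μ, Fin.cons_succ, Fin.val_succ]
        rw [add_mul, one_mul, Real.exp_add, Real.exp_log hx0, Real.rpow_def_of_pos hx0,
          mul_comm (Real.log x)]
        ring
    have h1 : |f ⟨x, hx.1⟩ - p ⟨x, hx.1⟩| ≤ 1 / (2 * C * b) := by
      rw [← Real.dist_eq]
      exact (ContinuousMap.dist_apply_le_dist _).trans hp.le
    rw [hval, abs_mul, abs_of_pos hx0]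
    calc _ ≤ b * (1 / (2 * C * b)) := mul_le_mul (hb hx.1) h1 (abs_nonneg _) hb0.le
      _ = _ := by field_simp
  have := hC n a _ hbound
  have ha : a 0 = 1 := rfl
  rw [ha, abs_one] at this
  have h2 : C * (1 / (2 * C)) = 1 / 2 := by field_simp
  rw [h2] at this
  norm_num at this

/-! ### Divergent sum: density -/

/-- Both `K * y ^ (-l) - ψ y` and `K * y ^ (-l) + ψ y` decrease on `[x, b]` and are nonnegative at
`b`. -/
theorem abs_le_mul_rpow_neg_of_deriv {ψ ψ' : ℝ → ℝ} {l K x b : ℝ} (hK : 0 ≤ K)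
    (hx : 0 < x) (hxb : x ≤ b) (hψ : ∀ y, 0 < y → HasDerivAt ψ (ψ' y) y) (hb : ψ b = 0)
    (hbound : ∀ y ∈ Set.Icc x b, |ψ' y| ≤ K * l * y ^ (-l - 1)) : |ψ x| ≤ K * x ^ (-l) := by
  have key : ∀ σ : ℝ, |σ| = 1 → σ * ψ x ≤ K * x ^ (-l) := by
    intro σ hσ
    have hder : ∀ y, 0 < y → HasDerivAt (fun y => K * y ^ (-l) - σ * ψ y)
        (K * (-l * y ^ (-l - 1)) - σ * ψ' y) y := fun y hy =>
      ((Real.hasDerivAt_rpow_const (Or.inl hy.ne')).const_mul K).sub ((hψ y hy).const_mul σ)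
    have hanti : AntitoneOn (fun y => K * y ^ (-l) - σ * ψ y) (Set.Icc x b) := by
      refine antitoneOn_of_deriv_nonpos (convex_Icc x b) ?_ ?_ ?_
      · exact fun y hy => (hder y (hx.trans_le hy.1)).continuousAt.continuousWithinAt
      · intro y hy
        rw [interior_Icc] at hy
        exact (hder y (hx.trans hy.1)).differentiableAt.differentiableWithinAt
      · intro y hy
        rw [interior_Icc] at hy
        rw [(hder y (hx.trans hy.1)).deriv]
        have h1 := hbound y ⟨hy.1.le, hy.2.le⟩
        have h2 := neg_abs_le (σ * ψ' y)
        rw [abs_mul, hσ, one_mul] at h2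
        linarith
    have h := hanti ⟨le_rfl, hxb⟩ ⟨hxb, le_rfl⟩ hxb
    simp only [hb, mul_zero, sub_zero] at h
    have : 0 ≤ K * b ^ (-l) := mul_nonneg hK (Real.rpow_nonneg (hx.le.trans hxb) _)
    linarith
  rw [abs_le']
  exact ⟨by simpa using key 1 (by simp), by simpa using key (-1) (by simp)⟩

/-- Approximation of `x ^ q` by powers, after von Golitschek. -/
theorem exists_rpow_approx {l : ℕ → ℝ} (hl : ∀ i, 0 < l i) (hinj : Function.Injective l) {q : ℝ}
    (hq : 0 < q) {b : ℝ} (hb : 0 < b) (n : ℕ) :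
    ∃ c : ℕ → ℝ, ∀ x ∈ Set.Ioc 0 b, |x ^ q - ∑ i ∈ Finset.range n, c i * x ^ l i| ≤
      b ^ q * ∏ i ∈ Finset.range n, |1 - q / l i| := by
  induction n with
  | zero =>
    refine ⟨0, fun x hx => ?_⟩
    simp only [Finset.range_zero, Finset.sum_empty, sub_zero, Finset.prod_empty, mul_one]
    rw [abs_of_nonneg (Real.rpow_nonneg hx.1.le _)]
    exact Real.rpow_le_rpow hx.1.le hx.2 hq.le
  | succ n ih =>
    obtain ⟨c, hc⟩ := ih
    set B := b ^ q * ∏ i ∈ Finset.range n, |1 - q / l i| with hB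
    have hB0 : 0 ≤ B := mul_nonneg (Real.rpow_nonneg hb.le _)
      (Finset.prod_nonneg fun i _ => abs_nonneg _)
    set L := l n with hL
    have hL0 : 0 < L := hl n
    -- With `Q` the current error, the next one is `(L - q) * x ^ L * ∫ y in x..b, y ^ (-L - 1) * Q
    -- y`. Here `ψ` is an explicit form of the integral with its factor `L - q`, `e i` are the
    -- coefficients that integration produces, and `r b` becomes the coefficient of `x ^ L`.
    let e : ℕ → ℝ := fun i => c i * ((L - q) / (L - l i))
    let r : ℝ → ℝ := fun y => y ^ (q - L) - ∑ i ∈ Finset.range n, e i * y ^ (l i - L)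
    let ψ : ℝ → ℝ := fun y => r y - r b
    let Q : ℝ → ℝ := fun y => y ^ q - ∑ i ∈ Finset.range n, c i * y ^ l i
    have hne : ∀ i ∈ Finset.range n, L - l i ≠ 0 := fun i hi => sub_ne_zero.2 fun h =>
      (Finset.mem_range.1 hi).ne' (hinj h)
    have hder : ∀ y, 0 < y → HasDerivAt ψ ((q - L) * (y ^ (-L - 1) * Q y)) y := by
      intro y hy
      have h1 : HasDerivAt ψ ((q - L) * y ^ (q - L - 1) -
          ∑ i ∈ Finset.range n, e i * ((l i - L) * y ^ (l i - L - 1))) y :=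
        ((Real.hasDerivAt_rpow_const (Or.inl hy.ne')).sub (HasDerivAt.fun_sum fun i _ =>
          (Real.hasDerivAt_rpow_const (Or.inl hy.ne')).const_mul _)).sub_const _
      refine h1.congr_deriv ?_
      have hpow : ∀ p, y ^ (p - L - 1) = y ^ (-L - 1) * y ^ p := fun p => by
        rw [← Real.rpow_add hy]; ring_nf
      simp only [Q, mul_sub, hpow, Finset.mul_sum]
      congr 1
      refine Finset.sum_congr rfl fun i hi => ?_
      have := hne i hi
      simp only [e]
      field_simp
      ring
    refine ⟨fun i => if i = n then r b else e i, fun x hx => ?_⟩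
    have hval : x ^ q - ∑ i ∈ Finset.range (n + 1), (if i = n then r b else e i) * x ^ l i =
        ψ x * x ^ L := by
      have hpow : ∀ p, x ^ (p - L) * x ^ L = x ^ p := fun p => by
        rw [← Real.rpow_add hx.1]; ring_nf
      rw [Finset.sum_range_succ, if_pos rfl]
      simp only [ψ, r, sub_mul, Finset.sum_mul, mul_assoc, hpow]
      have : ∑ i ∈ Finset.range n, (if i = n then r b else e i) * x ^ l i =
          ∑ i ∈ Finset.range n, e i * x ^ l i :=
        Finset.sum_congr rfl fun i hi => by rw [if_neg (Finset.mem_range.1 hi).ne]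
      rw [this, ← hL]
      ring
    have hmain : |ψ x| ≤ |1 - q / L| * B * x ^ (-L) := by
      refine abs_le_mul_rpow_neg_of_deriv (mul_nonneg (abs_nonneg _) hB0) hx.1 hx.2 hder
        (sub_self _) fun y hy => ?_
      have hy0 : 0 < y := hx.1.trans_le hy.1
      have h1 : |q - L| = |1 - q / L| * L := by
        rw [← abs_of_pos hL0, ← abs_mul, abs_of_pos hL0, abs_sub_comm]
        congr 1
        field_simp
      rw [abs_mul, abs_mul, h1, abs_of_pos (Real.rpow_pos_of_pos hy0 _)]
      have h2 := hc y ⟨hy0, hy.2⟩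
      calc _ ≤ |1 - q / L| * L * (y ^ (-L - 1) * B) := by
            refine mul_le_mul_of_nonneg_left (mul_le_mul_of_nonneg_left h2 ?_) ?_
            · exact Real.rpow_nonneg hy0.le _
            · exact mul_nonneg (abs_nonneg _) hL0.le
        _ = _ := by ring
    rw [hval, abs_mul, abs_of_pos (Real.rpow_pos_of_pos hx.1 _), Finset.prod_range_succ, ← mul_assoc]
    calc |ψ x| * x ^ L ≤ |1 - q / L| * B * x ^ (-L) * x ^ L :=
          mul_le_mul_of_nonneg_right hmain (Real.rpow_nonneg hx.1.le _)
      _ = B * |1 - q / L| := by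
          rw [mul_assoc, ← Real.rpow_add hx.1, neg_add_cancel, Real.rpow_zero]; ring

theorem muntzPower_mem_of_tendsto_prod {A : Set ℝ} (hA : IsCompact A) (hA0 : A ⊆ Set.Ici 0)
    {W : Submodule ℝ C(A, ℝ)} (hW : IsClosed (W : Set C(A, ℝ))) {l : ℕ → ℝ} (hl : ∀ i, 0 < l i)
    (hinj : Function.Injective l) (hlW : ∀ i, muntzPower A (l i) (hl i).le ∈ W) {q : ℝ} (hq : 0 < q)
    (hprod : Tendsto (fun n => ∏ i ∈ Finset.range n, |1 - q / l i|) atTop (nhds 0)) :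
    muntzPower A q hq.le ∈ W := by
  have hcomp : CompactSpace A := isCompact_iff_compactSpace.1 hA
  obtain ⟨b', hb'⟩ := hA.bddAbove
  obtain ⟨b, hb, hbA⟩ : ∃ b, 0 < b ∧ ∀ x ∈ A, x ≤ b :=
    ⟨max b' 1, by positivity, fun x hx => (hb' hx).trans (le_max_left _ _)⟩
  choose c hc using exists_rpow_approx hl hinj hq hb
  let f : ℕ → C(A, ℝ) := fun n => ∑ i ∈ Finset.range n, c n i • muntzPower A (l i) (hl i).le
  have hf : ∀ n, f n ∈ (W : Set C(A, ℝ)) := fun n =>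
    W.sum_mem fun i _ => W.smul_mem _ (hlW i)
  have hlim : Tendsto (fun n => b ^ q * ∏ i ∈ Finset.range n, |1 - q / l i|) atTop (nhds 0) := by
    simpa using hprod.const_mul (b ^ q)
  refine hW.mem_of_tendsto (b := atTop) (f := f) ?_ (Eventually.of_forall hf)
  rw [tendsto_iff_dist_tendsto_zero]
  refine squeeze_zero (fun n => dist_nonneg) (fun n => ?_) hlim
  have hnn : 0 ≤ b ^ q * ∏ i ∈ Finset.range n, |1 - q / l i| :=
    mul_nonneg (Real.rpow_nonneg hb.le _) (Finset.prod_nonneg fun i _ => abs_nonneg _)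
  rw [ContinuousMap.dist_le hnn]
  rintro ⟨x, hx⟩
  have hfx : f n ⟨x, hx⟩ = ∑ i ∈ Finset.range n, c n i * x ^ l i := by
    simp [f, ContinuousMap.sum_apply, muntzPower]
  rw [dist_comm, Real.dist_eq, hfx]
  -- The estimate covers only `(0, b]`; at `0` all the positive powers vanish.
  rcases (Set.mem_Ici.1 (hA0 hx)).eq_or_lt with rfl | hx0
  · have : ∑ i ∈ Finset.range n, c n i * (0 : ℝ) ^ l i = 0 :=
      Finset.sum_eq_zero fun i _ => by rw [Real.zero_rpow (hl i).ne', mul_zero]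
    rw [this]
    simpa [muntzPower, Real.zero_rpow hq.ne'] using hnn
  · exact hc n x ⟨hx0, hbA x hx⟩

/-- The estimate is applied to exponents accumulating at `P` from below. Iterating reaches every
positive power, even when `lam` is bounded. -/
theorem muntzPower_mem_of_lt {A : Set ℝ} (hA : IsCompact A) (hA0 : A ⊆ Set.Ici 0)
    {W : Submodule ℝ C(A, ℝ)} (hW : IsClosed (W : Set C(A, ℝ))) {P : ℝ} (hP : 0 < P)
    (h : ∀ q (hq : 0 < q), q < P → muntzPower A q hq.le ∈ W) {q : ℝ} (hq : 0 < q)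
    (hqP : q < 3 / 2 * P) : muntzPower A q hq.le ∈ W := by
  rcases lt_or_ge q P with hlt | hge
  · exact h q hq hlt
  have hfrac : ∀ i : ℕ, 0 < 1 / ((i : ℝ) + 16) ∧ 1 / ((i : ℝ) + 16) ≤ 1 / 16 := fun i =>
    ⟨by positivity, one_div_le_one_div_of_le (by norm_num) (by linarith [i.cast_nonneg (α := ℝ)])⟩
  -- These exponents lie in `[15 / 16 * P, P)`, so `q / l i` is between `1` and `3 / 2 * (16 / 15) =
  -- 8 / 5`.
  let l : ℕ → ℝ := fun i => P * (1 - 1 / ((i : ℝ) + 16))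
  have hl : ∀ i, 0 < l i := fun i => mul_pos hP (by linarith [(hfrac i).2])
  have hlP : ∀ i, l i < P := fun i => by
    have := mul_pos hP (hfrac i).1
    simp only [l]; linarith
  have hinj : Function.Injective l := by
    intro i j hij
    have h1 := mul_left_cancel₀ hP.ne' hij
    have h2 : ((i : ℝ) + 16)⁻¹ = ((j : ℝ) + 16)⁻¹ := by
      simp only [one_div] at h1; linarith
    exact_mod_cast add_right_cancel (inv_injective h2)
  refine muntzPower_mem_of_tendsto_prod hA hA0 hW hl hinj
    (fun i => h _ (hl i) (hlP i)) hq ?_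
  refine squeeze_zero (fun n => Finset.prod_nonneg fun i _ => abs_nonneg _) (fun n => ?_)
    (tendsto_pow_atTop_nhds_zero_of_lt_one (r := (3 / 5 : ℝ)) (by norm_num) (by norm_num))
  calc _ ≤ ∏ _i ∈ Finset.range n, (3 / 5 : ℝ) :=
        Finset.prod_le_prod (fun i _ => abs_nonneg _) fun i _ => by
          have h1 : q / l i ≤ 8 / 5 := by
            rw [div_le_iff₀ (hl i)]
            simp only [l]
            nlinarith [(hfrac i).2]
          have h2 : 1 ≤ q / l i := by
            rw [le_div_iff₀ (hl i)]
            linarith [hlP i]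
          rw [abs_le]
          constructor <;> linarith
    _ = _ := by rw [Finset.prod_const, Finset.card_range]

theorem dense_muntzSpace {lam : ℕ → ℝ} (hlam : IsMuntzSequence lam)
    {A : Set ℝ} (hA : IsCompact A) (hA0 : A ⊆ Set.Ici 0)
    (hsum : Tendsto (fun n => ∑ i ∈ Finset.range n, 1 / lam (i + 1)) atTop atTop) :
    Dense (muntzSpace A lam hlam : Set C(A, ℝ)) := by
  have hcomp : CompactSpace A := isCompact_iff_compactSpace.1 hA
  let W := (muntzSpace A lam hlam).topologicalClosure
  have hW : IsClosed (W : Set C(A, ℝ)) := Submodule.isClosed_topologicalClosure _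
  have hmem : ∀ i, muntzPower A (lam i) (hlam.nonneg i) ∈ W := fun i =>
    Submodule.le_topologicalClosure _ (Submodule.subset_span ⟨i, rfl⟩)
  have hpos : ∀ i, 0 < lam (i + 1) := fun i => hlam.zero ▸ hlam.strictMono (Nat.succ_pos i)
  -- For `q < lam 1` every factor `1 - q / lam (i + 1)` is in `[0, 1]` and at most `exp (-q / lam (i
  -- + 1))`.
  have h1 : ∀ q (hq : 0 < q), q < lam 1 → muntzPower A q hq.le ∈ W := by
    intro q hq hq1
    refine muntzPower_mem_of_tendsto_prod hA hA0 hW hpos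
      (hlam.strictMono.injective.comp (add_left_injective 1)) (fun i => hmem _) hq ?_
    have hexp : Tendsto (fun n => Real.exp (-(q * ∑ i ∈ Finset.range n, 1 / lam (i + 1)))) atTop
        (nhds 0) :=
      Real.tendsto_exp_neg_atTop_nhds_zero.comp (hsum.const_mul_atTop hq)
    refine squeeze_zero (fun n => Finset.prod_nonneg fun i _ => abs_nonneg _) (fun n => ?_) hexp
    rw [Finset.mul_sum, ← Finset.sum_neg_distrib, Real.exp_sum]
    refine Finset.prod_le_prod (fun i _ => abs_nonneg _) fun i _ => ?_
    have hle : q / lam (i + 1) ≤ 1 := by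
      rw [div_le_one (hpos i)]
      exact hq1.le.trans (hlam.strictMono.monotone (by omega))
    rw [abs_of_nonneg (by linarith), mul_one_div]
    exact Real.one_sub_le_exp_neg _
  have h2 : ∀ k : ℕ, ∀ q (hq : 0 < q), q < (3 / 2) ^ k * lam 1 → muntzPower A q hq.le ∈ W := by
    intro k
    induction k with
    | zero => simpa using h1
    | succ k ih =>
      intro q hq hqk
      refine muntzPower_mem_of_lt hA hA0 hW (mul_pos (by positivity) (hpos 0)) ih hq ?_
      rwa [← mul_assoc, ← pow_succ']
  have h3 : ∀ q (hq : 0 < q), muntzPower A q hq.le ∈ W := by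
    intro q hq
    obtain ⟨k, hk⟩ := pow_unbounded_of_one_lt (q / lam 1) (show (1 : ℝ) < 3 / 2 by norm_num)
    exact h2 k q hq ((div_lt_iff₀ (hpos 0)).1 hk)
  have hpow : ∀ k : ℕ, muntzPower A (k : ℝ) k.cast_nonneg ∈ W := by
    intro k
    -- The constants come from `lam 0 = 0`; the approximation argument gives positive powers only.
    rcases k.eq_zero_or_pos with rfl | hk
    · have := hmem 0
      simp only [hlam.zero] at this
      simpa using this
    · exact h3 k (Nat.cast_pos.2 hk)
  have hpoly : ∀ p : Polynomial ℝ, p.toContinuousMapOn A ∈ W := by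
    intro p
    induction p using Polynomial.induction_on' with
    | add p r hp hr =>
      have : (p + r).toContinuousMapOn A = p.toContinuousMapOn A + r.toContinuousMapOn A := by
        ext x; simp
      rw [this]
      exact W.add_mem hp hr
    | monomial k a =>
      have : (Polynomial.monomial k a).toContinuousMapOn A =
          a • muntzPower A (k : ℝ) k.cast_nonneg := by
        ext x; simp [muntzPower]
      rw [this]
      exact W.smul_mem _ (hpow k)
  have htop := ContinuousMap.subalgebra_topologicalClosure_eq_top_of_separatesPoints
    (polynomialFunctions A) (polynomialFunctions_separatesPoints A)
  intro f
  have hf : f ∈ (polynomialFunctions A).topologicalClosure := by rw [htop]; trivial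
  refine closure_minimal (t := (W : Set C(A, ℝ))) ?_ hW hf
  intro g hg
  have hg' : g ∈ (polynomialFunctions A : Set C(A, ℝ)) := hg
  rw [polynomialFunctions_coe] at hg'
  obtain ⟨p, rfl⟩ := hg'
  exact hpoly p

/-! ### The equivalence -/

theorem theorem3p2 (lam : ℕ → ℝ) (hlam : IsMuntzSequence lam)
    (A : Set ℝ) (hA : IsCompact A) (hA0 : A ⊆ Set.Ici 0) (hpos : 0 < volume A) :
    Dense (muntzSpace A lam hlam : Set C(A, ℝ)) ↔
      Tendsto (fun n : ℕ => ∑ i ∈ Finset.Icc 1 n, 1 / lam i) atTop atTop := by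
  have hIcc : (fun n : ℕ => ∑ i ∈ Finset.Icc 1 n, 1 / lam i) =
      fun n => ∑ i ∈ Finset.range n, 1 / lam (i + 1) := by
    funext n
    rw [Finset.range_eq_Ico, Finset.sum_Ico_add' (fun i => 1 / lam i) 0 n 1]
    rfl
  rw [hIcc]
  refine ⟨fun hd => ?_, dense_muntzSpace hlam hA hA0⟩
  by_contra hnot
  refine not_dense_muntzSpace hlam hA hA0 hpos ?_ hd
  by_contra hns
  exact hnot ((not_summable_iff_tendsto_nat_atTop_of_nonneg
    fun i => one_div_nonneg.2 (hlam.nonneg (i + 1))).1 hns)
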